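/- Let $\mathbb K$ be a field of characteristic different from $2$ and let $V=\bigoplus_{k\in\mathbb Z}V^k$ be a $\mathbb Z$-graded $\mathbb K$-vector space. In exponents of $-1$ a homogeneous vector stands for its degree. For a graded vector space $W$ let $sW$ be its suspension, $(sW)^k=W^{k-1}$, and let $CLV^n(W)=\prod_{i\ge1}\mathrm{Hom}^n(W^{\otimes i},W)$ be the space of degree $n$ linear maps $\bigoplus_{i\ge 1}W^{\otimes i}\to W$. The graded Balavoine bracket of $f=(f_i)_{i\ge1}\in CLV^m(W)$ and $g=(g_j)_{j\ge 1}\in CLV^n(W)$ is $[f,g]_B=f\bar\circ g-(-1)^{mn}g\bar\circ f\in CLV^{m+n}(W)$, where for homogeneous $v_1,\dots,v_s$ $$(f\bar\circ g)(v_1,\dots,v_s)=\sum_{i+j=s+1}\ \sum_{k=1}^{i}\ \sum_{\sigma\in S_{(k-1,j-1)}}(-1)^{n(v_{\sigma(1)}+\dots+v_{\sigma(k-1)})}\varepsilon(\sigma)\,f_i\big(v_{\sigma(1)},\dots,v_{\sigma(k-1)},g_j(v_{\sigma(k)},\dots,v_{\sigma(k+j-2)},v_{k+j-1}),v_{k+j},\dots,v_s\big),$$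 $S_{(p,q)}$ is the set of $(p,q)$-shuffles and $\varepsilon(\sigma)$ is the Koszul sign of the permutation $\sigma$ of the $v$'s. Let $CV^n(V)=\prod_{p\ge1}\mathrm{Hom}^{n+p-1}\big((V\otimes V)^{\otimes(p-1)}\otimes V,V\big)$, with elements written $f=\sum_{p\ge 1} f_{2p-1}$. For a component $f_{2p-1}$ of $f\in CV^n(V)$, homogeneous $X_1,\dots,X_{p-1}\in V\otimes V$ and homogeneous $x,y\in V$, put $$\widetilde f_p(X_1,\dots,X_{p-1},x\otimes y)=f_{2p-1}(X_1,\dots,X_{p-1},x)\otimes y+(-1)^{x(X_1+\dots+X_{p-1}+n+p-1)}\,x\otimes f_{2p-1}(X_1,\dots,X_{p-1},y)$$ and let $\Psi:CV^n(V)\to CLV^n(s(V\otimes V))$ be given by $(\Psi f_{2p-1})(sX_1,\dots,sX_{p-1},s(x\otimes y))=(-1)^{p(p-1)/2}\,s\,\widetilde f_p(X_1,\dots,X_{p-1},x\otimes y)$. Then the following hold. 1. $\Psi$ is a well-defined injective graded linear map. 2. $(CLV^\bullet(s(V\otimes V)),[\cdot,\cdot]_B)$ is a graded Lie algebra and $\mathrm{Im}\,\Psi$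 is a graded Lie subalgebra of it. 3. Consequently $CV^\bullet(V)$ is a graded Lie algebra with the bracket $[\![f,g]\!]=\Psi^{-1}\big([\Psi f,\Psi g]_B\big)$. Explicitly, $[\![f,g]\!]=f\circ g-(-1)^{mn}g\circ f$ for $f\in CV^m(V)$, $g\in CV^n(V)$, where, for homogeneous $X_1,\dots,X_s\in V\otimes V$ and $x\in V$, $$\begin{aligned}(f\circ g)(X_1,\dots,X_s,x)=\sum_{i+j=s+2}(-1)^{(i-1)(j-1)}\Big(&\sum_{k=1}^{i-1}\sum_{\sigma\in S_{(k-1,j-1)}}(-1)^{\beta_k}\varepsilon(\sigma)f_{2i-1}\big(X_{\sigma(1)},\dots,X_{\sigma(k-1)},\widetilde g_j(X_{\sigma(k)},\dots,X_{\sigma(k+j-2)},X_{k+j-1}),X_{k+j},\dots,X_s,x\big)\\&+\sum_{\sigma\in S_{(i-1,j-1)}}(-1)^{\beta_i}\varepsilon(\sigma)f_{2i-1}\big(X_{\sigma(1)},\dots,X_{\sigma(i-1)},g_{2j-1}(X_{\sigma(i)},\dots,X_{\sigma(s)},x)\big)\Big),\end{aligned}$$ with $i,j\ge1$, $\beta_k=n\sum_{l<k}(X_{\sigma(l)}+1)$,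 and $\varepsilon(\sigma)$ the Koszul sign of the permutation of the suspended vectors $sX_1,\dots,sX_s$, of degrees $X_l+1$. 4. An element $O=\sum_{k\ge1}O_{2k-1}$ is a Maurer–Cartan element of this graded Lie algebra (that is, $O\in CV^1(V)$ and $[\![O,O]\!]=0$) if and only if it is a homotopy Nambu algebra structure on $V$, i.e. every $O_{2k-1}:(V\otimes V)^{\otimes(k-1)}\otimes V\to V$ has degree $k$ and $(O\circ O)(X_1,\dots,X_s,x)=0$ for all $s\ge0$, all homogeneous $X_1,\dots,X_s\in V\otimes V$ and all $x\in V$. -/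

import Mathlib

open scoped TensorProduct

noncomputable section

namespace Nambu

universe u v

section Gradings

variable {𝕜 : Type u} [Field 𝕜] {W : Type v} [AddCommGroup W] [Module 𝕜 W]

/-- The grading of the suspension `s W`: `(s W)^k = W^(k-1)`. The underlying space is unchanged,
so that the degree one map `s : W → s W` is the identity on vectors. -/
def suspension (𝒲 : ℤ → Submodule 𝕜 W) : ℤ → Submodule 𝕜 W := fun k => 𝒲 (k - 1)

/-- The grading of `W ⊗ W`: the degree `k` part is spanned by the tensors `x ⊗ y` of homogeneous
vectors whose degrees add up to `k`. -/
def tensorGrading (𝒲 : ℤ → Submodule 𝕜 W) : ℤ → Submodule 𝕜 (W ⊗[𝕜] W) := fun k =>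
  Submodule.span 𝕜 {t | ∃ i j : ℤ, i + j = k ∧ ∃ x ∈ 𝒲 i, ∃ y ∈ 𝒲 j, x ⊗ₜ[𝕜] y = t}

theorem tmul_mem_tensorGrading {𝒲 : ℤ → Submodule 𝕜 W} {i j k : ℤ} (h : i + j = k) {x y : W}
    (hx : x ∈ 𝒲 i) (hy : y ∈ 𝒲 j) : x ⊗ₜ[𝕜] y ∈ tensorGrading 𝒲 k :=
  Submodule.subset_span ⟨i, j, h, x, hx, y, hy, rfl⟩

variable (𝒲 : ℤ → Submodule 𝕜 W) [DirectSum.Decomposition 𝒲]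

instance suspensionDecomposition : DirectSum.Decomposition (suspension 𝒲) :=
  DirectSum.Decomposition.ofLinearMap (suspension 𝒲)
    ((DirectSum.toModule 𝕜 ℤ (DirectSum ℤ fun i => suspension 𝒲 i) fun i =>
        (DirectSum.lof 𝕜 ℤ (fun i => suspension 𝒲 i) (i + 1)).comp
          (Submodule.inclusion (by simp [suspension]))) ∘ₗ
      (DirectSum.decomposeLinearEquiv 𝒲).toLinearMap)
    (by
      ext x
      induction x using DirectSum.Decomposition.inductionOn 𝒲 with
      | zero => simp
      | @homogeneous i m => simp [DirectSum.decomposeLinearEquiv_apply, DirectSum.toModule_lof,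
          ← DirectSum.lof_eq_of 𝕜]
      | add m m' h h' => rw [map_add, map_add, h, h'])
    (by
      ext i x : 2
      have hx : (x : W) ∈ 𝒲 (i - 1) := x.2
      simp only [LinearMap.comp_apply, DirectSum.coeLinearMap_lof, LinearEquiv.coe_coe,
        DirectSum.decomposeLinearEquiv_apply, LinearMap.id_comp]
      rw [DirectSum.decompose_of_mem 𝒲 hx, ← DirectSum.lof_eq_of 𝕜, DirectSum.toModule_lof]
      simp only [LinearMap.comp_apply]
      apply DFinsupp.single_eq_of_sigma_eq
      exact Sigma.subtype_ext (by simp) rfl)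

/-- The tensor product of two homogeneous components, inside the direct sum of the pieces of
`tensorGrading`. -/
def tensorPiece (i j : ℤ) :
    𝒲 i →ₗ[𝕜] 𝒲 j →ₗ[𝕜] DirectSum ℤ fun k => tensorGrading 𝒲 k :=
  LinearMap.mk₂ 𝕜
    (fun x y => DirectSum.lof 𝕜 ℤ (fun k => tensorGrading 𝒲 k) (i + j)
      ⟨(x : W) ⊗ₜ[𝕜] (y : W), tmul_mem_tensorGrading rfl x.2 y.2⟩)
    (fun x x' y => by
      rw [← map_add]; congr 1; ext; simp [TensorProduct.add_tmul])
    (fun c x y => by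
      rw [← map_smul]; congr 1)
    (fun x y y' => by
      rw [← map_add]; congr 1; ext; simp [TensorProduct.tmul_add])
    (fun c x y => by
      rw [← map_smul]; congr 1; ext; simp)

/-- The decomposition of a tensor into its homogeneous components. -/
def tensorDecompose : W ⊗[𝕜] W →ₗ[𝕜] DirectSum ℤ fun k => tensorGrading 𝒲 k :=
  TensorProduct.lift
    ((DirectSum.toModule 𝕜 ℤ (DirectSum ℤ (fun j => 𝒲 j) →ₗ[𝕜]
        DirectSum ℤ fun k => tensorGrading 𝒲 k) fun i =>
      LinearMap.flip (DirectSum.toModule 𝕜 ℤ _ fun j => (tensorPiece 𝒲 i j).flip)).compl₁₂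
      (DirectSum.decomposeLinearEquiv 𝒲).toLinearMap
      (DirectSum.decomposeLinearEquiv 𝒲).toLinearMap)

theorem tensorDecompose_tmul {i j k : ℤ} (h : i + j = k) {x y : W} (hx : x ∈ 𝒲 i)
    (hy : y ∈ 𝒲 j) :
    tensorDecompose 𝒲 (x ⊗ₜ[𝕜] y) = DirectSum.lof 𝕜 ℤ (fun k => tensorGrading 𝒲 k) k
      ⟨x ⊗ₜ[𝕜] y, tmul_mem_tensorGrading h hx hy⟩ := by
  subst h
  simp only [tensorDecompose, TensorProduct.lift.tmul, LinearMap.compl₁₂_apply,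
    LinearEquiv.coe_coe, DirectSum.decomposeLinearEquiv_apply]
  rw [DirectSum.decompose_of_mem 𝒲 hx, DirectSum.decompose_of_mem 𝒲 hy,
    ← DirectSum.lof_eq_of 𝕜, ← DirectSum.lof_eq_of 𝕜, DirectSum.toModule_lof,
    LinearMap.flip_apply, DirectSum.toModule_lof]
  rfl

instance tensorDecomposition : DirectSum.Decomposition (tensorGrading 𝒲) :=
  DirectSum.Decomposition.ofLinearMap (tensorGrading 𝒲) (tensorDecompose 𝒲)
    (by
      refine TensorProduct.ext' fun x y => ?_
      induction x using DirectSum.Decomposition.inductionOn 𝒲 with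
      | zero => simp
      | add m m' h h' => rw [TensorProduct.add_tmul, map_add, map_add, h, h']
      | homogeneous m =>
        induction y using DirectSum.Decomposition.inductionOn 𝒲 with
        | zero => simp
        | add m m' h h' => rw [TensorProduct.tmul_add, map_add, map_add, h, h']
        | homogeneous m' =>
          rw [LinearMap.comp_apply, tensorDecompose_tmul 𝒲 rfl m.2 m'.2,
            DirectSum.coeLinearMap_lof]
          rfl)
    (by
      ext k t : 2
      obtain ⟨t, ht⟩ := t
      simp only [LinearMap.comp_apply, DirectSum.coeLinearMap_lof, LinearMap.id_comp]
      induction ht using Submodule.span_induction with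
      | mem t h =>
        obtain ⟨i, j, h, x, hx, y, hy, rfl⟩ := h
        exact tensorDecompose_tmul 𝒲 h hx hy
      | zero => exact (map_zero _).trans (map_zero _).symm
      | add a b ha hb h h' =>
        have e : (⟨a + b, Submodule.add_mem _ ha hb⟩ : tensorGrading 𝒲 k) =
          ⟨a, ha⟩ + ⟨b, hb⟩ := rfl
        rw [map_add, h, h', ← map_add, ← e]
      | smul c a ha h =>
        have e : (⟨c • a, Submodule.smul_mem _ c ha⟩ : tensorGrading 𝒲 k) = c • ⟨a, ha⟩ := rfl
        rw [map_smul, h, ← map_smul, ← e])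

/-- The projection of a graded space onto its even part (`c = 0`) or odd part (`c = 1`). -/
def parityProj (c : Fin 2) : W →ₗ[𝕜] W :=
  (DirectSum.toModule 𝕜 ℤ W fun i => if i % 2 = ((c : ℕ) : ℤ) then (𝒲 i).subtype else 0) ∘ₗ
    (DirectSum.decomposeLinearEquiv 𝒲).toLinearMap

theorem parityProj_of_mem (c : Fin 2) {i : ℤ} {x : W} (hx : x ∈ 𝒲 i) :
    parityProj 𝒲 c x = if i % 2 = ((c : ℕ) : ℤ) then x else 0 := by
  simp only [parityProj, LinearMap.comp_apply, LinearEquiv.coe_coe,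
    DirectSum.decomposeLinearEquiv_apply]
  rw [DirectSum.decompose_of_mem 𝒲 hx, ← DirectSum.lof_eq_of 𝕜, DirectSum.toModule_lof]
  split_ifs <;> rfl

end Gradings

section Signs

/-- The sign `(-1)^n`. -/
def sign (𝕜 : Type u) [Field 𝕜] (n : ℤ) : 𝕜 := if Even n then 1 else -1

/-- The Koszul sign `ε(σ)` of a permutation of homogeneous vectors of degrees `d`: every pair of
vectors that is interchanged contributes `(-1)` to the product of the two degrees. -/
def koszulSign (𝕜 : Type u) [Field 𝕜] {N : ℕ} (d : Fin N → ℤ) (σ : Equiv.Perm (Fin N)) : 𝕜 :=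
  sign 𝕜 (∑ i : Fin N, ∑ j : Fin N, if i < j ∧ σ j < σ i then d (σ i) * d (σ j) else 0)

open Classical in
/-- The `(k, b)`-shuffles, as permutations of `Fin N` that move only the first `k + b` places:
they are increasing on the first `k` places and on the following `b` places. -/
def shuffles (N k b : ℕ) : Finset (Equiv.Perm (Fin N)) :=
  Finset.univ.filter fun σ =>
    (∀ i j : Fin N, i < j → (j : ℕ) < k → σ i < σ j) ∧
    (∀ i j : Fin N, k ≤ (i : ℕ) → i < j → (j : ℕ) < k + b → σ i < σ j) ∧
    (∀ i : Fin N, k + b ≤ (i : ℕ) → σ i = i)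

/-- `d_{σ(1)} + ⋯ + d_{σ(k)}`. -/
def leadingDegree {N : ℕ} (d : Fin N → ℤ) (σ : Equiv.Perm (Fin N)) (k : ℕ) : ℤ :=
  ∑ i : Fin N, if (i : ℕ) < k then d (σ i) else 0

end Signs

section Balavoine

variable {𝕜 : Type u} [Field 𝕜] {W : Type v} [AddCommGroup W] [Module 𝕜 W]

/-- Linear maps from the reduced tensor module `⊕_{i ≥ 1} W^{⊗ i}` to `W`, given by their
components: the entry at `a` is the component on `W^{⊗ (a+1)}`. -/
abbrev LeibnizCochain (𝕜 : Type u) [Field 𝕜] (W : Type v) [AddCommGroup W] [Module 𝕜 W] :=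
  (a : ℕ) → MultilinearMap 𝕜 (fun _ : Fin (a + 1) => W) W

/-- The space of linear maps of degree `n` from `⊕_{i ≥ 1} W^{⊗ i}` to `W`. -/
def CLV (𝒲 : ℤ → Submodule 𝕜 W) (n : ℤ) : Submodule 𝕜 (LeibnizCochain 𝕜 W) where
  carrier := {f | ∀ (a : ℕ) (d : Fin (a + 1) → ℤ) (v : Fin (a + 1) → W),
    (∀ i, v i ∈ 𝒲 (d i)) → f a v ∈ 𝒲 (∑ i, d i + n)}
  zero_mem' := fun _ _ _ _ => Submodule.zero_mem _
  add_mem' := fun hf hg a d v hv => Submodule.add_mem _ (hf a d v hv) (hg a d v hv)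
  smul_mem' := fun c _ hf a d v hv => Submodule.smul_mem _ c (hf a d v hv)

/-- The values `f(w_1, …, w_k, g(w_{k+1}, …, w_{k+b+1}), w_{k+b+2}, …, w_{a+b+1})`. -/
def insertFun {a b : ℕ} (f : MultilinearMap 𝕜 (fun _ : Fin (a + 1) => W) W)
    (g : MultilinearMap 𝕜 (fun _ : Fin (b + 1) => W) W) (k : Fin (a + 1))
    (w : Fin (a + b + 1) → W) : W :=
  f fun t =>
    if (t : ℕ) < k then w ⟨t, by omega⟩
    else if t = k then g fun r => w ⟨k + r, by omega⟩
    else w ⟨t + b, by omega⟩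

theorem insertFun_update {a b : ℕ} (f : MultilinearMap 𝕜 (fun _ : Fin (a + 1) => W) W)
    (g : MultilinearMap 𝕜 (fun _ : Fin (b + 1) => W) W) (k : Fin (a + 1))
    (w : Fin (a + b + 1) → W) (l : Fin (a + b + 1)) :
    ∃ L : W →ₗ[𝕜] W, ∀ x, insertFun f g k (Function.update w l x) = L x := by
  set outer : W → (Fin (a + b + 1) → W) → Fin (a + 1) → W := fun y w t =>
    if (t : ℕ) < k then w ⟨t, by omega⟩ else if t = k then y else w ⟨t + b, by omega⟩
    with houter
  have key : ∀ w, insertFun f g k w = f (outer (g fun r => w ⟨k + r, by omega⟩) w) :=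
    fun w => rfl
  by_cases h1 : (l : ℕ) < k
  · refine ⟨f.toLinearMap (outer (g fun r => w ⟨k + r, by omega⟩) w) ⟨l, by omega⟩, fun x => ?_⟩
    rw [key, MultilinearMap.toLinearMap_apply]
    congr 1
    funext t
    simp only [houter, Function.update_apply, Fin.ext_iff]
    split_ifs <;> first | rfl | omega | skip
    all_goals
      congr 1
      funext r
      rw [if_neg (by omega)]
  · by_cases h2 : (l : ℕ) ≤ k + b
    · refine ⟨(f.toLinearMap (outer 0 w) k) ∘ₗ
        (g.toLinearMap (fun r => w ⟨k + r, by omega⟩) ⟨l - k, by omega⟩), fun x => ?_⟩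
      rw [key, LinearMap.comp_apply, MultilinearMap.toLinearMap_apply,
        MultilinearMap.toLinearMap_apply]
      congr 1
      funext t
      simp only [houter, Function.update_apply, Fin.ext_iff]
      split_ifs <;> first | rfl | omega | skip
      all_goals
        congr 1
        funext r
        simp only [Function.update_apply, Fin.ext_iff]
        split_ifs <;> first | rfl | omega
    · refine ⟨f.toLinearMap (outer (g fun r => w ⟨k + r, by omega⟩) w) ⟨l - b, by omega⟩,
        fun x => ?_⟩
      rw [key, MultilinearMap.toLinearMap_apply]
      congr 1
      funext t
      simp only [houter, Function.update_apply, Fin.ext_iff]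
      split_ifs <;> first | rfl | omega | skip
      all_goals
        congr 1
        funext r
        rw [if_neg (by omega)]

/-- The insertion of `g` into the place `k` of `f`, without signs, as a multilinear map. -/
def insertAt {a b : ℕ} (f : MultilinearMap 𝕜 (fun _ : Fin (a + 1) => W) W)
    (g : MultilinearMap 𝕜 (fun _ : Fin (b + 1) => W) W) (k : Fin (a + 1)) :
    MultilinearMap 𝕜 (fun _ : Fin (a + b + 1) => W) W where
  toFun := insertFun f g k
  map_update_add' := fun {inst} w l x y => by
    rw [Subsingleton.elim inst (instDecidableEqFin _)]
    obtain ⟨L, hL⟩ := insertFun_update f g k w l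
    rw [hL, hL, hL, map_add]
  map_update_smul' := fun {inst} w l c x => by
    rw [Subsingleton.elim inst (instDecidableEqFin _)]
    obtain ⟨L, hL⟩ := insertFun_update f g k w l
    rw [hL, hL, map_smul]

/-- Given, for all degrees `d` of the arguments, a multilinear map `F d` that depends on `d` only
through parities, the multilinear map whose value on homogeneous arguments of degrees `d` is that
of `F d` (see `homogeneousGlue_apply`): split every argument into its even and its odd part. -/
def homogeneousGlue {M N : Type v} [AddCommGroup M] [Module 𝕜 M] [AddCommGroup N] [Module 𝕜 N]
    (ℳ : ℤ → Submodule 𝕜 M) [DirectSum.Decomposition ℳ] {r : ℕ}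
    (F : (Fin r → ℤ) → MultilinearMap 𝕜 (fun _ : Fin r => M) N) :
    MultilinearMap 𝕜 (fun _ : Fin r => M) N :=
  ∑ e : Fin r → Fin 2,
    (F fun i => ((e i : ℕ) : ℤ)).compLinearMap fun i => parityProj ℳ (e i)

theorem homogeneousGlue_apply {M N : Type v} [AddCommGroup M] [Module 𝕜 M] [AddCommGroup N]
    [Module 𝕜 N] (ℳ : ℤ → Submodule 𝕜 M) [DirectSum.Decomposition ℳ] {r : ℕ}
    (F : (Fin r → ℤ) → MultilinearMap 𝕜 (fun _ : Fin r => M) N)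
    (hF : ∀ d d' : Fin r → ℤ, (∀ i, d i % 2 = d' i % 2) → F d = F d')
    (d : Fin r → ℤ) (v : Fin r → M) (hv : ∀ i, v i ∈ ℳ (d i)) :
    homogeneousGlue ℳ F v = F d v := by
  have hlt : ∀ i, (d i % 2).toNat < 2 := fun i => by omega
  rw [homogeneousGlue, sum_apply,
    Finset.sum_eq_single (fun i => (⟨(d i % 2).toNat, hlt i⟩ : Fin 2))]
  · rw [MultilinearMap.compLinearMap_apply, hF _ d (fun i => by simp; omega)]
    congr 1
    funext i
    rw [parityProj_of_mem ℳ _ (hv i), if_pos]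
    simp; omega
  · intro e _ he
    obtain ⟨i, hi⟩ := Function.ne_iff.mp he
    rw [MultilinearMap.compLinearMap_apply]
    refine MultilinearMap.map_coord_zero _ i ?_
    rw [parityProj_of_mem ℳ _ (hv i), if_neg]
    intro h
    exact hi (Fin.ext (by simp; omega))
  · simp

variable (𝒲 : ℤ → Submodule 𝕜 W) [DirectSum.Decomposition 𝒲]

/-- The circle product of a component `f` on `W^{⊗ (a+1)}` with a component `g` on
`W^{⊗ (b+1)}` of degree `n`. On homogeneous arguments `v_0, …, v_{a+b}` it is the sum over
`0 ≤ k ≤ a` and over the `(k, b)`-shuffles `σ` of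
`(-1)^{n (|v_{σ(0)}| + ⋯ + |v_{σ(k-1)}|)} ε(σ)` times
`f(v_{σ(0)}, …, v_{σ(k-1)}, g(v_{σ(k)}, …, v_{σ(k+b-1)}, v_{k+b}), v_{k+b+1}, …, v_{a+b})`. -/
def circComponent (n : ℤ) {a b : ℕ} (f : MultilinearMap 𝕜 (fun _ : Fin (a + 1) => W) W)
    (g : MultilinearMap 𝕜 (fun _ : Fin (b + 1) => W) W) :
    MultilinearMap 𝕜 (fun _ : Fin (a + b + 1) => W) W :=
  homogeneousGlue 𝒲 fun d =>
    ∑ k : Fin (a + 1), ∑ σ ∈ shuffles (a + b + 1) k b,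
      (sign 𝕜 (n * leadingDegree d σ k) * koszulSign 𝕜 d σ) •
        (insertAt f g k).domDomCongr σ

/-- The circle product `f ∘ g` for `g` of degree `n`. -/
def circ (n : ℤ) (f g : LeibnizCochain 𝕜 W) : LeibnizCochain 𝕜 W := fun s =>
  ∑ p ∈ (Finset.HasAntidiagonal.antidiagonal s).attach,
    (circComponent 𝒲 n (f p.1.1) (g p.1.2)).domDomCongr
      (finCongr (congrArg (· + 1) (Finset.HasAntidiagonal.mem_antidiagonal.mp p.2)))

/-- The graded Balavoine bracket of `f` of degree `m` and `g` of degree `n`. -/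
def balavoineBracket (m n : ℤ) (f g : LeibnizCochain 𝕜 W) : LeibnizCochain 𝕜 W :=
  circ 𝒲 n f g - sign 𝕜 (m * n) • circ 𝒲 m g f

end Balavoine

section GradedLie

variable {𝕜 : Type u} [Field 𝕜] {M : Type v} [AddCommGroup M] [Module 𝕜 M]

/-- The graded vector space with degree `n` part `L n`, together with the operations
`br m n : L m × L n → L (m + n)`, is a graded Lie algebra. -/
structure IsGradedLieAlgebra (L : ℤ → Submodule 𝕜 M) (br : ℤ → ℤ → M → M → M) : Prop where
  mem : ∀ m n, ∀ f ∈ L m, ∀ g ∈ L n, br m n f g ∈ L (m + n)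
  add_left : ∀ m n, ∀ f ∈ L m, ∀ f' ∈ L m, ∀ g ∈ L n,
    br m n (f + f') g = br m n f g + br m n f' g
  smul_left : ∀ m n, ∀ (c : 𝕜), ∀ f ∈ L m, ∀ g ∈ L n, br m n (c • f) g = c • br m n f g
  add_right : ∀ m n, ∀ f ∈ L m, ∀ g ∈ L n, ∀ g' ∈ L n,
    br m n f (g + g') = br m n f g + br m n f g'
  smul_right : ∀ m n, ∀ (c : 𝕜), ∀ f ∈ L m, ∀ g ∈ L n, br m n f (c • g) = c • br m n f g
  antisymm : ∀ m n, ∀ f ∈ L m, ∀ g ∈ L n, br m n f g = -(sign 𝕜 (m * n) • br n m g f)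
  jacobi : ∀ m n p, ∀ f ∈ L m, ∀ g ∈ L n, ∀ h ∈ L p,
    br m (n + p) f (br n p g h) =
      br (m + n) p (br m n f g) h + sign 𝕜 (m * n) • br n (m + p) g (br m p f h)

/-- `S` is a graded Lie subalgebra of the graded Lie algebra `(L, br)`. -/
structure IsGradedLieSubalgebra (L : ℤ → Submodule 𝕜 M) (br : ℤ → ℤ → M → M → M)
    (S : ℤ → Submodule 𝕜 M) : Prop where
  isGradedLieAlgebra : IsGradedLieAlgebra L br
  le : ∀ n, S n ≤ L n
  bracket_mem : ∀ m n, ∀ f ∈ S m, ∀ g ∈ S n, br m n f g ∈ S (m + n)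

/-- Maurer-Cartan elements: degree one elements `f` with `[f, f] = 0`. -/
def IsMaurerCartan (L : ℤ → Submodule 𝕜 M) (br : ℤ → ℤ → M → M → M) (f : M) : Prop :=
  f ∈ L 1 ∧ br 1 1 f f = 0

end GradedLie

section NambuCochains

variable {𝕜 : Type u} [Field 𝕜] {V : Type v} [AddCommGroup V] [Module 𝕜 V]

/-- Linear maps from `⊕_{p ≥ 1} (V ⊗ V)^{⊗ (p-1)} ⊗ V` to `V`, given by their components: the
entry at `a` is the component on `(V ⊗ V)^{⊗ a} ⊗ V`, curried in the last factor. -/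
abbrev NambuCochain (𝕜 : Type u) [Field 𝕜] (V : Type v) [AddCommGroup V] [Module 𝕜 V] :=
  (a : ℕ) → MultilinearMap 𝕜 (fun _ : Fin a => V ⊗[𝕜] V) (V →ₗ[𝕜] V)

/-- The degree `n` part: the component on `(V ⊗ V)^{⊗ a} ⊗ V` has degree `n + a`. -/
def CV (𝒱 : ℤ → Submodule 𝕜 V) (n : ℤ) : Submodule 𝕜 (NambuCochain 𝕜 V) where
  carrier := {f | ∀ (a : ℕ) (d : Fin a → ℤ) (c : ℤ) (X : Fin a → V ⊗[𝕜] V) (x : V),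
    (∀ i, X i ∈ tensorGrading 𝒱 (d i)) → x ∈ 𝒱 c → f a X x ∈ 𝒱 (∑ i, d i + c + (n + a))}
  zero_mem' := fun _ _ _ _ _ _ _ => Submodule.zero_mem _
  add_mem' := fun hf hg a d c X x hX hx =>
    Submodule.add_mem _ (hf a d c X x hX hx) (hg a d c X x hX hx)
  smul_mem' := fun r _ hf a d c X x hX hx => Submodule.smul_mem _ r (hf a d c X x hX hx)

variable (𝒱 : ℤ → Submodule 𝕜 V) [DirectSum.Decomposition 𝒱]

/-- For a component `φ` of degree `q`, the map that sends homogeneous `X_1, …, X_a` and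
`x ⊗ y` to `φ(X_1, …, X_a, x) ⊗ y + (-1)^{|x| (|X_1| + ⋯ + |X_a| + q)} x ⊗ φ(X_1, …, X_a, y)`,
see `leibnizExt_apply`. -/
def leibnizExt (q : ℤ) {a : ℕ} (φ : MultilinearMap 𝕜 (fun _ : Fin a => V ⊗[𝕜] V) (V →ₗ[𝕜] V)) :
    MultilinearMap 𝕜 (fun _ : Fin a => V ⊗[𝕜] V) (V ⊗[𝕜] V →ₗ[𝕜] V ⊗[𝕜] V) :=
  ((TensorProduct.mapBilinear (RingHom.id 𝕜) V V V V).flip LinearMap.id).compMultilinearMap φ +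
  homogeneousGlue (tensorGrading 𝒱) fun d =>
    ∑ c : Fin 2, sign 𝕜 (((c : ℕ) : ℤ) * (∑ i, d i + q)) •
      (TensorProduct.mapBilinear (RingHom.id 𝕜) V V V V (parityProj 𝒱 c)).compMultilinearMap φ

theorem sign_congr {m n : ℤ} (h : m % 2 = n % 2) : sign 𝕜 m = sign 𝕜 n := by
  unfold sign
  simp only [Int.even_iff, h]

theorem leibnizExt_apply (q : ℤ) {a : ℕ}
    (φ : MultilinearMap 𝕜 (fun _ : Fin a => V ⊗[𝕜] V) (V →ₗ[𝕜] V)) (d : Fin a → ℤ) (c : ℤ)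
    (X : Fin a → V ⊗[𝕜] V) (x y : V) (hX : ∀ i, X i ∈ tensorGrading 𝒱 (d i)) (hx : x ∈ 𝒱 c) :
    leibnizExt 𝒱 q φ X (x ⊗ₜ[𝕜] y) =
      φ X x ⊗ₜ[𝕜] y + sign 𝕜 (c * (∑ i, d i + q)) • x ⊗ₜ[𝕜] φ X y := by
  rw [leibnizExt, add_apply, homogeneousGlue_apply (d := d) (hv := hX)]
  · simp only [LinearMap.compMultilinearMap_apply, LinearMap.add_apply, LinearMap.flip_apply,
      Fin.sum_univ_two, add_apply, smul_apply,
      LinearMap.smul_apply, TensorProduct.mapBilinear_apply, TensorProduct.map_tmul,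
      parityProj_of_mem 𝒱 _ hx, LinearMap.id_apply]
    congr 1
    rcases Int.even_or_odd c with h | h
    · have h0 : c % 2 = 0 := Int.even_iff.mp h
      simp [h0, sign, h.mul_right]
    · have h1 : c % 2 = 1 := Int.odd_iff.mp h
      rw [sign_congr (𝕜 := 𝕜) (m := c * (∑ i, d i + q)) (n := ∑ i, d i + q)]
      · simp [h1]
      · rw [Int.mul_emod, h1]; simp
  · intro d d' h
    refine Finset.sum_congr rfl fun c _ => ?_
    congr 1
    refine sign_congr ?_
    have hs : (∑ i, d i) % 2 = (∑ i, d' i) % 2 := by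
      rw [Finset.sum_int_mod, Finset.sum_int_mod (f := d')]
      simp only [h]
    refine Int.ModEq.mul_left _ (Int.ModEq.add_right _ hs)

theorem leibnizExt_add (q : ℤ) {a : ℕ}
    (φ ψ : MultilinearMap 𝕜 (fun _ : Fin a => V ⊗[𝕜] V) (V →ₗ[𝕜] V)) :
    leibnizExt 𝒱 q (φ + ψ) = leibnizExt 𝒱 q φ + leibnizExt 𝒱 q ψ := by
  ext X : 1
  simp only [leibnizExt, homogeneousGlue, add_apply, sum_apply,
    MultilinearMap.compLinearMap_apply, smul_apply,
    LinearMap.compMultilinearMap_apply, map_add, smul_add, Finset.sum_add_distrib]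
  abel

theorem leibnizExt_smul (q : ℤ) {a : ℕ} (r : 𝕜)
    (φ : MultilinearMap 𝕜 (fun _ : Fin a => V ⊗[𝕜] V) (V →ₗ[𝕜] V)) :
    leibnizExt 𝒱 q (r • φ) = r • leibnizExt 𝒱 q φ := by
  ext X : 1
  simp only [leibnizExt, homogeneousGlue, add_apply, sum_apply,
    MultilinearMap.compLinearMap_apply, smul_apply,
    LinearMap.compMultilinearMap_apply, map_smul, smul_add, Finset.smul_sum]
  simp only [smul_comm r]

/-- The map `Ψ` in degree `n`: the component on `(V ⊗ V)^{⊗ (p-1)} ⊗ V`, of degree `n + p - 1`,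
is sent to `(-1)^{p(p-1)/2}` times its extension to `(s(V ⊗ V))^{⊗ p}`; here `p = a + 1`. -/
def Psi (n : ℤ) : NambuCochain 𝕜 V →ₗ[𝕜] LeibnizCochain 𝕜 (V ⊗[𝕜] V) where
  toFun f := fun a => sign 𝕜 (((a + 1) * a / 2 : ℕ) : ℤ) •
    (leibnizExt 𝒱 (n + a) (f a)).uncurryRight
  map_add' f g := by
    funext a
    ext v
    simp [leibnizExt_add]
  map_smul' r f := by
    funext a
    ext v
    simp only [Pi.smul_apply, leibnizExt_smul, smul_apply,
      MultilinearMap.uncurryRight_apply, LinearMap.smul_apply, RingHom.id_apply]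
    rw [smul_comm]

/-- The grading of `s(V ⊗ V)`. -/
abbrev suspTensor (𝒱 : ℤ → Submodule 𝕜 V) : ℤ → Submodule 𝕜 (V ⊗[𝕜] V) :=
  suspension (tensorGrading 𝒱)

/-- The transported bracket `Ψ⁻¹ [Ψ f, Ψ g]` of `f` of degree `m` and `g` of degree `n`. -/
def courant (m n : ℤ) (f g : NambuCochain 𝕜 V) : NambuCochain 𝕜 V :=
  Function.invFunOn (Psi 𝒱 (m + n)) (CV 𝒱 (m + n))
    (balavoineBracket (suspTensor 𝒱) m n (Psi 𝒱 m f) (Psi 𝒱 n g))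

/-- The contribution of the components `f`, on `(V ⊗ V)^{⊗ a} ⊗ V`, and `g`, on
`(V ⊗ V)^{⊗ b} ⊗ V`, of cochains of which the second has degree `n`, to the circle product,
evaluated on homogeneous `X_0, …, X_{a+b-1}` of degrees `d` in `V ⊗ V` and on `x`. All signs are
formed with the degrees `d i + 1` of the suspended vectors `s X_i`. -/
def nambuCircComponent (n : ℤ) {a b : ℕ}
    (f : MultilinearMap 𝕜 (fun _ : Fin a => V ⊗[𝕜] V) (V →ₗ[𝕜] V))
    (g : MultilinearMap 𝕜 (fun _ : Fin b => V ⊗[𝕜] V) (V →ₗ[𝕜] V))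
    (d : Fin (a + b) → ℤ) (X : Fin (a + b) → V ⊗[𝕜] V) (x : V) : V :=
  sign 𝕜 (a * b) •
    ((∑ k : Fin a, ∑ σ ∈ shuffles (a + b) k b,
        (sign 𝕜 (n * leadingDegree (fun i => d i + 1) σ k) *
            koszulSign 𝕜 (fun i => d i + 1) σ) •
          f (fun t =>
              if (t : ℕ) < k then X (σ ⟨t, by omega⟩)
              else if t = k then
                leibnizExt 𝒱 (n + b) g (fun r => X (σ ⟨k + r, by omega⟩)) (X ⟨k + b, by omega⟩)
              else X ⟨t + b, by omega⟩) x) +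
      ∑ σ ∈ shuffles (a + b) a b,
        (sign 𝕜 (n * leadingDegree (fun i => d i + 1) σ a) *
            koszulSign 𝕜 (fun i => d i + 1) σ) •
          f (fun t => X (σ ⟨t, by omega⟩)) (g (fun r => X (σ ⟨a + r, by omega⟩)) x))

/-- The value of the circle product `f ∘ g`, with `g` of degree `n`, on homogeneous
`X_0, …, X_{s-1}` of degrees `d` in `V ⊗ V` and on `x`. -/
def nambuCirc (n : ℤ) (f g : NambuCochain 𝕜 V) (s : ℕ) (d : Fin s → ℤ)
    (X : Fin s → V ⊗[𝕜] V) (x : V) : V :=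
  ∑ p ∈ (Finset.HasAntidiagonal.antidiagonal s).attach,
    nambuCircComponent 𝒱 n (f p.1.1) (g p.1.2)
      (fun i => d (Fin.cast (Finset.HasAntidiagonal.mem_antidiagonal.mp p.2) i))
      (fun i => X (Fin.cast (Finset.HasAntidiagonal.mem_antidiagonal.mp p.2) i)) x

/-- A homotopy Nambu algebra structure on `V`: maps `O a : (V ⊗ V)^{⊗ a} ⊗ V → V` of degree
`a + 1` for `a ≥ 0` that satisfy the identities `O ∘ O = 0` on all homogeneous arguments. -/
structure IsHomotopyNambu (O : NambuCochain 𝕜 V) : Prop where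
  degree : ∀ (a : ℕ) (d : Fin a → ℤ) (c : ℤ) (X : Fin a → V ⊗[𝕜] V) (x : V),
    (∀ i, X i ∈ tensorGrading 𝒱 (d i)) → x ∈ 𝒱 c → O a X x ∈ 𝒱 (∑ i, d i + c + (a + 1))
  identity : ∀ (s : ℕ) (d : Fin s → ℤ) (X : Fin s → V ⊗[𝕜] V) (x : V),
    (∀ i, X i ∈ tensorGrading 𝒱 (d i)) → nambuCirc 𝒱 1 O O s d X x = 0

end NambuCochains

end Nambu

end

/-!
The sign of a shuffle is the price of moving one letter at a time, so both circle products are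
determined by a recursion on the first letter of a word `v :: l`: either `v` goes into `g`, or it
stays in front and `g` moves past it. In this form `g` acts as a coderivation, the commutator of two
coderivations is the coderivation of the commutator, and this gives the graded Jacobi identity.

`Ψ f` acts on the last letter of a word only, by the extension of an endomorphism of `V` to a
graded derivation of `V ⊗ V`. Such extensions are closed under graded commutators, hence the image
of `Ψ` is closed under the bracket. The map `Ψ` is injective: if `φ x ⊗ y ± x ⊗ φ y = 0` for all
homogeneous `x` and `y`, then `φ x` is a multiple of `x`, so that a nonzero `φ` would have degree
zero, the sign would be positive, and `2 (φ x ⊗ x) = 0`. The explicit bracket comes from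
unfolding the recursion into shuffles, and Maurer–Cartan elements are as claimed because
`[O, O] = 2 O ∘ O` for `O` of degree one.
-/

noncomputable section

namespace Nambu

universe u v

section Sign

variable (𝕜 : Type*) [Field 𝕜]

@[simp] theorem sign_zero : sign 𝕜 0 = 1 := by simp [sign]

theorem sign_add (m n : ℤ) : sign 𝕜 (m + n) = sign 𝕜 m * sign 𝕜 n := by
  unfold sign
  by_cases hm : Even m <;> by_cases hn : Even n <;> simp [hm, hn, Int.even_add]

theorem sign_eq_one_or_eq_neg_one (n : ℤ) : sign 𝕜 n = 1 ∨ sign 𝕜 n = -1 := by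
  unfold sign
  split_ifs <;> simp

theorem sign_mul_self (n : ℤ) : sign 𝕜 n * sign 𝕜 n = 1 := by
  rcases sign_eq_one_or_eq_neg_one 𝕜 n with h | h <;> simp [h]

end Sign

/-- A word of vectors, each labelled with the degree it has in the sign rule; the label of a
letter need not be the degree of its vector, see `IsHomogeneousWord`. -/
abbrev Word (W : Type*) := List (ℤ × W)

section CircleProduct

variable (𝕜 : Type*) [Field 𝕜] {W M : Type*} [AddCommGroup M] [Module 𝕜 M]

/-- The values `f ↦ (f ∘ g)(l)` of the circle product with a map `g` of degree `n`. The first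
letter `v` of a word is either an argument of `f` standing before `g`, or an argument of `g` that
is not its last one, or the only argument of `g`. -/
def wordCircAt : Word W → ℤ → (Word W → W) → (Word W → M) →ₗ[𝕜] M
  | [], _, _ => 0
  | v :: l, n, g =>
    sign 𝕜 (n * v.1) • wordCircAt l n g ∘ₗ LinearMap.funLeft 𝕜 M (List.cons v) +
      wordCircAt l (n + v.1) (g ∘ List.cons v) + LinearMap.proj ((v.1 + n, g [v]) :: l)

/-- The circle product `f ↦ f ∘ g` of maps on words, for `g` of degree `n`, as a linear map. For
`M = W` it is the action of the coderivation with corestriction `g`. -/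
def wordCirc (n : ℤ) (g : Word W → W) : (Word W → M) →ₗ[𝕜] Word W → M :=
  LinearMap.pi fun l => wordCircAt 𝕜 l n g

@[simp] theorem wordCirc_nil (n : ℤ) (g : Word W → W) (f : Word W → M) :
    wordCirc 𝕜 n g f [] = 0 := rfl

theorem wordCirc_cons (n : ℤ) (g : Word W → W) (f : Word W → M) (v : ℤ × W) (l : Word W) :
    wordCirc 𝕜 n g f (v :: l) = sign 𝕜 (n * v.1) • wordCirc 𝕜 n g (f ∘ List.cons v) l +
      wordCirc 𝕜 (n + v.1) (g ∘ List.cons v) f l + f ((v.1 + n, g [v]) :: l) := rfl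

theorem wordCirc_comp_cons (n : ℤ) (g : Word W → W) (f : Word W → M) (v : ℤ × W) :
    wordCirc 𝕜 n g f ∘ List.cons v = sign 𝕜 (n * v.1) • wordCirc 𝕜 n g (f ∘ List.cons v) +
      wordCirc 𝕜 (n + v.1) (g ∘ List.cons v) f + f ∘ List.cons (v.1 + n, g [v]) := rfl

variable [AddCommGroup W] [Module 𝕜 W]

variable (W M) in
/-- The maps on words that are linear in every letter. -/
def wordLinear : Submodule 𝕜 (Word W → M) where
  carrier := {f | ∀ u d w, IsLinearMap 𝕜 fun x => f (u ++ (d, x) :: w)}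
  zero_mem' := fun _ _ _ => (0 : W →ₗ[𝕜] M).isLinear
  add_mem' := fun hf hg u d w => ((hf u d w).mk' _ + (hg u d w).mk' _).isLinear
  smul_mem' := fun c _ hf u d w => (c • (hf u d w).mk' _).isLinear

variable {𝕜}

theorem comp_cons_mem_wordLinear {f : Word W → M} (hf : f ∈ wordLinear 𝕜 W M) (v : ℤ × W) :
    f ∘ List.cons v ∈ wordLinear 𝕜 W M := fun u => hf (v :: u)

theorem isLinearMap_cons {f : Word W → M} (hf : f ∈ wordLinear 𝕜 W M) (d : ℤ) (l : Word W) :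
    IsLinearMap 𝕜 fun x => f ((d, x) :: l) := hf [] d l

theorem isLinearMap_comp_cons {f : Word W → M} (hf : f ∈ wordLinear 𝕜 W M) (d : ℤ) :
    IsLinearMap 𝕜 fun x => f ∘ List.cons (d, x) :=
  (LinearMap.pi fun l => (isLinearMap_cons hf d l).mk' _).isLinear

theorem isLinearMap_wordCirc_left {f : Word W → M} (hf : f ∈ wordLinear 𝕜 W M) (n : ℤ)
    (l : Word W) : IsLinearMap 𝕜 fun g => wordCirc 𝕜 n g f l := by
  induction l generalizing n f with
  | nil => exact (0 : (Word W → W) →ₗ[𝕜] M).isLinear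
  | cons v l ih =>
    exact (sign 𝕜 (n * v.1) • (ih (comp_cons_mem_wordLinear hf v) n).mk' _ +
      (ih hf (n + v.1)).mk' _ ∘ₗ LinearMap.funLeft 𝕜 W (List.cons v) +
      (isLinearMap_cons hf (v.1 + n) l).mk' _ ∘ₗ LinearMap.proj [v]).isLinear

theorem wordCirc_mem_wordLinear {f : Word W → M} {g : Word W → W} (hf : f ∈ wordLinear 𝕜 W M)
    (hg : g ∈ wordLinear 𝕜 W W) (n : ℤ) : wordCirc 𝕜 n g f ∈ wordLinear 𝕜 W M := by
  intro u d w
  induction u generalizing n f g with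
  | nil =>
    exact (sign 𝕜 (n * d) • wordCircAt 𝕜 w n g ∘ₗ (isLinearMap_comp_cons hf d).mk' _ +
      (isLinearMap_wordCirc_left hf (n + d) w).mk' _ ∘ₗ (isLinearMap_comp_cons hg d).mk' _ +
      (isLinearMap_cons hf (d + n) w).mk' _ ∘ₗ (isLinearMap_cons hg d []).mk' _).isLinear
  | cons v u ih =>
    exact (sign 𝕜 (n * v.1) • (ih (comp_cons_mem_wordLinear hf v) hg n).mk' _ +
      (ih hf (comp_cons_mem_wordLinear hg v) (n + v.1)).mk' _ +
      (hf ((v.1 + n, g [v]) :: u) d w).mk' _).isLinear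

variable (𝕜) in
/-- The graded commutator of the circle product, for `f` of degree `m` and `g` of degree `n`. -/
def wordBracket (m n : ℤ) (f g : Word W → W) : Word W → W :=
  wordCirc 𝕜 n g f - sign 𝕜 (m * n) • wordCirc 𝕜 m f g

theorem wordBracket_comp_cons (m n : ℤ) (f g : Word W → W) (v : ℤ × W) :
    wordBracket 𝕜 m n f g ∘ List.cons v =
      sign 𝕜 (n * v.1) • wordBracket 𝕜 (m + v.1) n (f ∘ List.cons v) g +
        wordBracket 𝕜 m (n + v.1) f (g ∘ List.cons v) +
        (f ∘ List.cons (v.1 + n, g [v]) -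
          sign 𝕜 (m * n) • g ∘ List.cons (v.1 + m, f [v])) := by
  simp only [wordBracket, Pi.sub_comp, Pi.smul_comp, wordCirc_comp_cons, add_mul, mul_add, sign_add,
    mul_comm v.1]
  match_scalars <;> grind [sign_mul_self]

theorem wordBracket_singleton (m n : ℤ) (f g : Word W → W) (v : ℤ × W) :
    wordBracket 𝕜 m n f g [v] =
      f [(v.1 + n, g [v])] - sign 𝕜 (m * n) • g [(v.1 + m, f [v])] := by
  simp [wordBracket, wordCirc_cons]

theorem wordCirc_wordBracket {f : Word W → M} (hf : f ∈ wordLinear 𝕜 W M) (n p : ℤ)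
    (g h : Word W → W) :
    wordCirc 𝕜 (n + p) (wordBracket 𝕜 n p g h) f =
      wordCirc 𝕜 p h (wordCirc 𝕜 n g f) -
        sign 𝕜 (n * p) • wordCirc 𝕜 n g (wordCirc 𝕜 p h f) := by
  funext l
  induction l generalizing n p g h f with
  | nil => simp
  | cons v l ih =>
    have linear_left := fun n => isLinearMap_wordCirc_left hf n l
    have linear_cons := isLinearMap_cons hf (v.1 + (n + p)) l
    have ih_f := ih (comp_cons_mem_wordLinear hf v) n p g h
    have ih_g := ih hf (n + v.1) p (g ∘ List.cons v) h
    have ih_h := ih hf n (p + v.1) g (h ∘ List.cons v)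
    rw [show n + v.1 + p = n + p + v.1 by ring] at ih_g
    rw [show n + (p + v.1) = n + p + v.1 by ring] at ih_h
    simp only [wordCirc_cons, wordBracket_comp_cons, wordBracket_singleton,
      (linear_left _).map_add, (linear_left _).map_sub, (linear_left _).map_smul,
      linear_cons.map_sub, linear_cons.map_smul, ih_f, ih_g, ih_h, Pi.sub_apply, Pi.smul_apply,
      wordCirc_comp_cons, map_add, map_smul, Pi.add_apply]
    rw [show v.1 + p + n = v.1 + (n + p) by ring, show v.1 + n + p = v.1 + (n + p) by ring,
      show n + (v.1 + p) = n + p + v.1 by ring, show p + (v.1 + n) = n + p + v.1 by ring]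
    simp only [mul_add, add_mul, sign_add, mul_comm v.1, mul_comm p n]
    match_scalars <;> grind [sign_mul_self]

theorem wordBracket_jacobi {f g h : Word W → W} (hf : f ∈ wordLinear 𝕜 W W)
    (hg : g ∈ wordLinear 𝕜 W W) (hh : h ∈ wordLinear 𝕜 W W) (m n p : ℤ) :
    wordBracket 𝕜 m (n + p) f (wordBracket 𝕜 n p g h) =
      wordBracket 𝕜 (m + n) p (wordBracket 𝕜 m n f g) h +
        sign 𝕜 (m * n) • wordBracket 𝕜 n (m + p) g (wordBracket 𝕜 m p f h) := by
  rw [wordBracket, wordBracket.eq_1 𝕜 (m + n), wordBracket.eq_1 𝕜 n (m + p),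
    wordCirc_wordBracket hf, wordCirc_wordBracket hg, wordCirc_wordBracket hh]
  simp only [wordBracket, map_sub, map_smul, mul_add, add_mul, sign_add, mul_comm n m]
  match_scalars <;> grind [sign_mul_self]

end CircleProduct

section HomogeneousWords

variable {𝕜 W M : Type*} [Field 𝕜]

/-- The sum of the degrees of the letters of a word. -/
def wordDegree (l : Word W) : ℤ := (l.map Prod.fst).sum

@[simp] theorem wordDegree_nil : wordDegree ([] : Word W) = 0 := rfl

@[simp] theorem wordDegree_cons (v : ℤ × W) (l : Word W) :
    wordDegree (v :: l) = v.1 + wordDegree l := List.sum_cons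

variable [AddCommGroup M] [Module 𝕜 M]

/-- The map on words that applies the member of the family `T` indexed by the degree of the value
`f l`, when `f` has degree `m`. -/
def mapByDegree {M' : Type*} [AddCommGroup M'] [Module 𝕜 M'] (T : ℤ → M →ₗ[𝕜] M') (m : ℤ)
    (f : Word W → M) : Word W → M' := fun l => T (wordDegree l + m) (f l)

theorem mapByDegree_comp_cons {M' : Type*} [AddCommGroup M'] [Module 𝕜 M']
    (T : ℤ → M →ₗ[𝕜] M') (m : ℤ) (f : Word W → M) (v : ℤ × W) :
    mapByDegree T m f ∘ List.cons v = mapByDegree T (m + v.1) (f ∘ List.cons v) := by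
  funext l
  simp only [mapByDegree, Function.comp_apply, wordDegree_cons]
  congr 2
  ring

theorem wordCirc_mapByDegree {M' : Type*} [AddCommGroup M'] [Module 𝕜 M']
    (T : ℤ → M →ₗ[𝕜] M') (m n : ℤ) (g : Word W → W) (f : Word W → M) :
    wordCirc 𝕜 n g (mapByDegree T m f) = mapByDegree T (m + n) (wordCirc 𝕜 n g f) := by
  funext l
  induction l generalizing m n g f with
  | nil => simp [mapByDegree]
  | cons v l ih =>
    simp only [wordCirc_cons, mapByDegree_comp_cons, ih, mapByDegree, wordDegree_cons, map_add,
      map_smul]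
    rw [show wordDegree l + (m + v.1 + n) = v.1 + wordDegree l + (m + n) by ring,
      show wordDegree l + (m + (n + v.1)) = v.1 + wordDegree l + (m + n) by ring,
      show v.1 + n + wordDegree l + m = v.1 + wordDegree l + (m + n) by ring]

theorem wordCirc_congr {P : ℤ × W → ℤ × W → Prop} (hP : ∀ v v', P v v' → v.1 % 2 = v'.1 % 2)
    {n n' : ℤ} (hn : n % 2 = n' % 2) {g g' : Word W → W} {f f' : Word W → M}
    (hf : ∀ l l', List.Forall₂ P l l' → f l = f' l')
    (hg : ∀ l l', l ≠ [] → List.Forall₂ P l l' →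
      P (wordDegree l + n, g l) (wordDegree l' + n', g' l'))
    {l l' : Word W} (hl : List.Forall₂ P l l') :
    wordCirc 𝕜 n g f l = wordCirc 𝕜 n' g' f' l' := by
  induction hl generalizing n n' g g' f f' with
  | nil => simp
  | @cons v v' l l' hv hl ih =>
    have hd := hP _ _ hv
    rw [wordCirc_cons, wordCirc_cons, sign_congr (𝕜 := 𝕜) (Int.ModEq.mul hn hd),
      ih (f := f ∘ List.cons v) (f' := f' ∘ List.cons v') hn
        (fun w w' hw => hf _ _ (.cons hv hw)) hg,
      ih (g := g ∘ List.cons v) (g' := g' ∘ List.cons v') (Int.ModEq.add hn hd) hf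
        fun w w' _ hw => ?_]
    · congr 1
      refine hf _ _ (.cons ?_ hl)
      simpa using hg [v] [v'] (by simp) (.cons hv .nil)
    · convert hg (v :: w) (v' :: w') (by simp) (.cons hv hw) using 2 <;>
        simp only [Function.comp_apply, wordDegree_cons] <;> ring

variable [AddCommGroup W] [Module 𝕜 W]

/-- The words in which every letter is homogeneous of the degree it is labelled with. -/
def IsHomogeneousWord (𝒲 : ℤ → Submodule 𝕜 W) (l : Word W) : Prop := ∀ v ∈ l, v.2 ∈ 𝒲 v.1

@[simp] theorem isHomogeneousWord_nil (𝒲 : ℤ → Submodule 𝕜 W) : IsHomogeneousWord 𝒲 [] :=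
  List.forall_mem_nil _

@[simp] theorem isHomogeneousWord_cons {𝒲 : ℤ → Submodule 𝕜 W} {v : ℤ × W} {l : Word W} :
    IsHomogeneousWord 𝒲 (v :: l) ↔ v.2 ∈ 𝒲 v.1 ∧ IsHomogeneousWord 𝒲 l := List.forall_mem_cons

/-- The maps on words that are of degree `n` on homogeneous words. -/
def homogeneousWordMap (𝒲 : ℤ → Submodule 𝕜 W) (ℳ : ℤ → Submodule 𝕜 M) (n : ℤ) :
    Submodule 𝕜 (Word W → M) where
  carrier := {f | ∀ l, IsHomogeneousWord 𝒲 l → f l ∈ ℳ (wordDegree l + n)}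
  zero_mem' := fun _ _ => Submodule.zero_mem _
  add_mem' := fun hf hg l hl => Submodule.add_mem _ (hf l hl) (hg l hl)
  smul_mem' := fun c _ hf l hl => Submodule.smul_mem _ c (hf l hl)

variable {𝒲 : ℤ → Submodule 𝕜 W} {ℳ : ℤ → Submodule 𝕜 M} {m n : ℤ}

theorem comp_cons_mem_homogeneousWordMap {f : Word W → M} (hf : f ∈ homogeneousWordMap 𝒲 ℳ n)
    {v : ℤ × W} (hv : v.2 ∈ 𝒲 v.1) :
    f ∘ List.cons v ∈ homogeneousWordMap 𝒲 ℳ (n + v.1) := fun l hl => by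
  have hvl := hf (v :: l) (isHomogeneousWord_cons.2 ⟨hv, hl⟩)
  rwa [wordDegree_cons, show v.1 + wordDegree l + n = wordDegree l + (n + v.1) by ring] at hvl

theorem singleton_mem_of_mem_homogeneousWordMap {g : Word W → M}
    (hg : g ∈ homogeneousWordMap 𝒲 ℳ n) {v : ℤ × W} (hv : v.2 ∈ 𝒲 v.1) :
    g [v] ∈ ℳ (v.1 + n) := by
  simpa using hg [v] (by simpa using hv)

theorem wordCirc_mem_homogeneousWordMap {f : Word W → M} {g : Word W → W}
    (hf : f ∈ homogeneousWordMap 𝒲 ℳ m) (hg : g ∈ homogeneousWordMap 𝒲 𝒲 n) :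
    wordCirc 𝕜 n g f ∈ homogeneousWordMap 𝒲 ℳ (m + n) := by
  intro l
  induction l generalizing m n f g with
  | nil => exact fun _ => Submodule.zero_mem _
  | cons v l ih =>
    intro hvl
    obtain ⟨hv, hl⟩ := isHomogeneousWord_cons.1 hvl
    have before := ih (comp_cons_mem_homogeneousWordMap hf hv) hg hl
    have inside := ih hf (comp_cons_mem_homogeneousWordMap hg hv) hl
    have last := hf ((v.1 + n, g [v]) :: l)
      (isHomogeneousWord_cons.2 ⟨singleton_mem_of_mem_homogeneousWordMap hg hv, hl⟩)
    rw [wordDegree_cons, show v.1 + wordDegree l + (m + n) = wordDegree l + (m + v.1 + n) by ring]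
    rw [show m + (n + v.1) = m + v.1 + n by ring] at inside
    rw [wordDegree_cons, show v.1 + n + wordDegree l + m = wordDegree l + (m + v.1 + n) by ring]
      at last
    exact Submodule.add_mem _ (Submodule.add_mem _ (Submodule.smul_mem _ _ before) inside) last

theorem wordBracket_mem_homogeneousWordMap {f g : Word W → W}
    (hf : f ∈ homogeneousWordMap 𝒲 𝒲 m) (hg : g ∈ homogeneousWordMap 𝒲 𝒲 n) :
    wordBracket 𝕜 m n f g ∈ homogeneousWordMap 𝒲 𝒲 (m + n) :=
  Submodule.sub_mem _ (wordCirc_mem_homogeneousWordMap hf hg)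
    (Submodule.smul_mem _ _ (add_comm n m ▸ wordCirc_mem_homogeneousWordMap hg hf))

theorem forall₂_eq_and_mem_iff {l l' : Word W} :
    List.Forall₂ (fun v v' => v.2 ∈ 𝒲 v.1 ∧ v = v') l l' ↔ IsHomogeneousWord 𝒲 l ∧ l = l' := by
  rw [List.forall₂_and_left, List.forall₂_eq_eq_eq, IsHomogeneousWord]

theorem wordCirc_congr_of_isHomogeneousWord {g g' : Word W → W} {f f' : Word W → M}
    (hf : ∀ l, IsHomogeneousWord 𝒲 l → f l = f' l)
    (hg : ∀ l, l ≠ [] → IsHomogeneousWord 𝒲 l → g l ∈ 𝒲 (wordDegree l + n) ∧ g l = g' l)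
    {l : Word W} (hl : IsHomogeneousWord 𝒲 l) : wordCirc 𝕜 n g f l = wordCirc 𝕜 n g' f' l := by
  refine wordCirc_congr (P := fun v v' => v.2 ∈ 𝒲 v.1 ∧ v = v') (fun v v' h => by rw [h.2]) rfl
    (fun l l' h => ?_) (fun l l' h0 h => ?_) (forall₂_eq_and_mem_iff.2 ⟨hl, rfl⟩)
  · obtain ⟨hom, rfl⟩ := forall₂_eq_and_mem_iff.1 h
    exact hf l hom
  · obtain ⟨hom, rfl⟩ := forall₂_eq_and_mem_iff.1 h
    exact ⟨(hg l h0 hom).1, by rw [(hg l h0 hom).2]⟩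

theorem wordBracket_congr_of_isHomogeneousWord {f f' g g' : Word W → W}
    (hf : f ∈ homogeneousWordMap 𝒲 𝒲 m) (hg : g ∈ homogeneousWordMap 𝒲 𝒲 n)
    (hff' : ∀ l, IsHomogeneousWord 𝒲 l → f l = f' l)
    (hgg' : ∀ l, IsHomogeneousWord 𝒲 l → g l = g' l) {l : Word W} (hl : IsHomogeneousWord 𝒲 l) :
    wordBracket 𝕜 m n f g l = wordBracket 𝕜 m n f' g' l := by
  simp only [wordBracket, Pi.sub_apply, Pi.smul_apply]
  rw [wordCirc_congr_of_isHomogeneousWord hff' (fun l _ h => ⟨hg l h, hgg' l h⟩) hl,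
    wordCirc_congr_of_isHomogeneousWord hgg' (fun l _ h => ⟨hf l h, hff' l h⟩) hl]

end HomogeneousWords

section Convolution

variable (𝕜 : Type*) [Field 𝕜] {W A : Type*} [Ring A] [Algebra 𝕜 A]

/-- The values `(f, g) ↦ (f ∗ g)(l)` of the shuffle convolution product, for `g` of degree `n`: the
first letter of a word is an argument either of `f` or of `g`. -/
def wordConvAt : Word W → ℤ → (Word W → A) →ₗ[𝕜] (Word W → A) →ₗ[𝕜] A
  | [], _ => (LinearMap.mul 𝕜 A).compl₁₂ (LinearMap.proj []) (LinearMap.proj [])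
  | v :: l, n =>
    sign 𝕜 (n * v.1) • wordConvAt l n ∘ₗ LinearMap.funLeft 𝕜 A (List.cons v) +
      (wordConvAt l (n + v.1)).compl₂ (LinearMap.funLeft 𝕜 A (List.cons v))

/-- The shuffle convolution product of algebra-valued maps on words, for `g` of degree `n`. -/
def wordConv (n : ℤ) (f g : Word W → A) : Word W → A := fun l => wordConvAt 𝕜 l n f g

@[simp] theorem wordConv_nil (n : ℤ) (f g : Word W → A) : wordConv 𝕜 n f g [] = f [] * g [] := rfl

theorem wordConv_cons (n : ℤ) (f g : Word W → A) (v : ℤ × W) (l : Word W) :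
    wordConv 𝕜 n f g (v :: l) = sign 𝕜 (n * v.1) • wordConv 𝕜 n (f ∘ List.cons v) g l +
      wordConv 𝕜 (n + v.1) f (g ∘ List.cons v) l := rfl

/-- The graded commutator of the convolution product, for `f` of degree `m` and `g` of
degree `n`. -/
def wordConvBracket (m n : ℤ) (f g : Word W → A) : Word W → A :=
  wordConv 𝕜 n f g - sign 𝕜 (m * n) • wordConv 𝕜 m g f

variable {𝕜}

theorem wordConvBracket_nil (m n : ℤ) (f g : Word W → A) :
    wordConvBracket 𝕜 m n f g [] = f [] * g [] - sign 𝕜 (m * n) • (g [] * f []) := rfl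

theorem wordConvBracket_cons (m n : ℤ) (f g : Word W → A) (v : ℤ × W) (l : Word W) :
    wordConvBracket 𝕜 m n f g (v :: l) =
      sign 𝕜 (n * v.1) • wordConvBracket 𝕜 (m + v.1) n (f ∘ List.cons v) g l +
        wordConvBracket 𝕜 m (n + v.1) f (g ∘ List.cons v) l := by
  simp only [wordConvBracket, Pi.sub_apply, Pi.smul_apply, wordConv_cons, add_mul, mul_add,
    sign_add, mul_comm v.1]
  match_scalars <;> grind [sign_mul_self]

theorem wordConv_congr {P : ℤ × W → ℤ × W → Prop} (hP : ∀ v v', P v v' → v.1 % 2 = v'.1 % 2)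
    {n n' : ℤ} (hn : n % 2 = n' % 2) {g g' f f' : Word W → A}
    (hf : ∀ l l', List.Forall₂ P l l' → f l = f' l')
    (hg : ∀ l l', List.Forall₂ P l l' → g l = g' l')
    {l l' : Word W} (hl : List.Forall₂ P l l') :
    wordConv 𝕜 n f g l = wordConv 𝕜 n' f' g' l' := by
  induction hl generalizing n n' g g' f f' with
  | nil => rw [wordConv_nil, wordConv_nil, hf _ _ .nil, hg _ _ .nil]
  | @cons v v' l l' hv _ ih =>
    have hd := hP _ _ hv
    rw [wordConv_cons, wordConv_cons, sign_congr (𝕜 := 𝕜) (Int.ModEq.mul hn hd),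
      ih (f := f ∘ List.cons v) (f' := f' ∘ List.cons v') hn
        (fun w w' hw => hf _ _ (.cons hv hw)) hg,
      ih (g := g ∘ List.cons v) (g' := g' ∘ List.cons v') (Int.ModEq.add hn hd) hf
        (fun w w' hw => hg _ _ (.cons hv hw))]

variable [AddCommGroup W] [Module 𝕜 W]

theorem wordConv_mem_wordLinear {f g : Word W → A} (hf : f ∈ wordLinear 𝕜 W A)
    (hg : g ∈ wordLinear 𝕜 W A) (n : ℤ) : wordConv 𝕜 n f g ∈ wordLinear 𝕜 W A := by
  intro u d w
  induction u generalizing n f g with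
  | nil =>
    exact (sign 𝕜 (n * d) • (wordConvAt 𝕜 w n).flip g ∘ₗ (isLinearMap_comp_cons hf d).mk' _ +
      wordConvAt 𝕜 w (n + d) f ∘ₗ (isLinearMap_comp_cons hg d).mk' _).isLinear
  | cons v u ih =>
    exact (sign 𝕜 (n * v.1) • (ih (comp_cons_mem_wordLinear hf v) hg n).mk' _ +
      (ih hf (comp_cons_mem_wordLinear hg v) (n + v.1)).mk' _).isLinear

variable {𝒲 : ℤ → Submodule 𝕜 W} {ℳ : ℤ → Submodule 𝕜 A} {m n : ℤ} {f g : Word W → A}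

theorem wordConv_mem_homogeneousWordMap
    (hℳ : ∀ i j, ∀ a ∈ ℳ i, ∀ b ∈ ℳ j, a * b ∈ ℳ (i + j))
    (hf : f ∈ homogeneousWordMap 𝒲 ℳ m) (hg : g ∈ homogeneousWordMap 𝒲 ℳ n) :
    wordConv 𝕜 n f g ∈ homogeneousWordMap 𝒲 ℳ (m + n) := by
  intro l
  induction l generalizing m n f g with
  | nil => exact fun hl => by simpa using hℳ _ _ _ (hf [] hl) _ (hg [] hl)
  | cons v l ih =>
    intro hvl
    obtain ⟨hv, hl⟩ := isHomogeneousWord_cons.1 hvl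
    have left := ih (comp_cons_mem_homogeneousWordMap hf hv) hg hl
    have right := ih hf (comp_cons_mem_homogeneousWordMap hg hv) hl
    rw [wordDegree_cons, show v.1 + wordDegree l + (m + n) = wordDegree l + (m + v.1 + n) by ring]
    rw [show m + (n + v.1) = m + v.1 + n by ring] at right
    exact Submodule.add_mem _ (Submodule.smul_mem _ _ left) right

theorem wordConvBracket_mapByDegree {B : Type*} [Ring B] [Algebra 𝕜 B] {T : ℤ → A →ₗ[𝕜] B}
    (hT : ∀ i j, ∀ a ∈ ℳ i, ∀ b ∈ ℳ j, T i a * T j b - sign 𝕜 (i * j) • (T j b * T i a) =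
      T (i + j) (a * b - sign 𝕜 (i * j) • (b * a)))
    (hf : f ∈ homogeneousWordMap 𝒲 ℳ m) (hg : g ∈ homogeneousWordMap 𝒲 ℳ n)
    {l : Word W} (hl : IsHomogeneousWord 𝒲 l) :
    wordConvBracket 𝕜 m n (mapByDegree T m f) (mapByDegree T n g) l =
      mapByDegree T (m + n) (wordConvBracket 𝕜 m n f g) l := by
  induction l generalizing m n f g with
  | nil =>
    simpa [wordConvBracket_nil, mapByDegree] using
      hT m n _ (by simpa using hf [] hl) _ (by simpa using hg [] hl)
  | cons v l ih =>
    obtain ⟨hv, hl⟩ := isHomogeneousWord_cons.1 hl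
    rw [wordConvBracket_cons, mapByDegree_comp_cons, mapByDegree_comp_cons,
      ih (comp_cons_mem_homogeneousWordMap hf hv) hg hl,
      ih hf (comp_cons_mem_homogeneousWordMap hg hv) hl]
    simp only [mapByDegree, wordConvBracket_cons, wordDegree_cons, map_add, map_smul]
    rw [show wordDegree l + (m + v.1 + n) = v.1 + wordDegree l + (m + n) by ring,
      show wordDegree l + (m + (n + v.1)) = v.1 + wordDegree l + (m + n) by ring]

theorem wordCirc_append_singleton {f g : Word W → W} {F G : Word W → Module.End 𝕜 W}
    (hf : ∀ l z, f (l ++ [z]) = F l z.2) (hg : ∀ l z, g (l ++ [z]) = G l z.2) (n : ℤ)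
    (l : Word W) (z : ℤ × W) :
    wordCirc 𝕜 n g f (l ++ [z]) = (wordCirc 𝕜 n g F l + wordConv 𝕜 n F G l) z.2 := by
  induction l generalizing n f g F G with
  | nil =>
    have hf_singleton := hf [] (z.1 + n, g [z])
    have hg_singleton := hg [] z
    simp only [List.nil_append] at hf_singleton hg_singleton
    simp [wordCirc_cons, hf_singleton, ← hg_singleton]
  | cons v l ih =>
    have before := ih (f := f ∘ List.cons v) (F := F ∘ List.cons v) (fun l => hf (v :: l)) hg n
    have inside := ih (g := g ∘ List.cons v) (G := G ∘ List.cons v) hf (fun l => hg (v :: l))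
      (n + v.1)
    have last := hf ((v.1 + n, g [v]) :: l) z
    simp only [List.cons_append, wordCirc_cons, wordConv_cons] at last ⊢
    rw [before, inside, last]
    simp only [LinearMap.add_apply, LinearMap.smul_apply]
    module

end Convolution

section Shuffles

open Finset.HasAntidiagonal (antidiagonal mem_antidiagonal)

/-- The permutation of `Fin (N + 1)` that sends `p` to `0` and is `σ` on the other places. It is a
shuffle only if `σ` is one and `p` is the first place of a block, which gives the recursion for
sums over shuffles. -/
def insertPerm {N : ℕ} (p : Fin (N + 1)) (σ : Equiv.Perm (Fin N)) : Equiv.Perm (Fin (N + 1)) :=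
  ((finSuccEquiv' p).trans σ.optionCongr).trans (finSuccEquiv' 0).symm

variable {N k b : ℕ}

@[simp] theorem insertPerm_self (p : Fin (N + 1)) (σ : Equiv.Perm (Fin N)) :
    insertPerm p σ p = 0 := by simp [insertPerm]

@[simp] theorem insertPerm_succAbove (p : Fin (N + 1)) (σ : Equiv.Perm (Fin N)) (i : Fin N) :
    insertPerm p σ (p.succAbove i) = (σ i).succ := by simp [insertPerm]

@[simp] theorem insertPerm_zero_succ (σ : Equiv.Perm (Fin N)) (i : Fin N) :
    insertPerm 0 σ i.succ = (σ i).succ := insertPerm_succAbove 0 σ i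

theorem insertPerm_bijective (N : ℕ) : Function.Bijective
    fun x : Fin (N + 1) × Equiv.Perm (Fin N) => insertPerm x.1 x.2 := by
  rw [Fintype.bijective_iff_injective_and_card]
  constructor
  · rintro ⟨p, σ⟩ ⟨q, τ⟩ h
    obtain rfl : p = q := (insertPerm q τ).injective <| by
      rw [insertPerm_self, ← show insertPerm p σ = insertPerm q τ from h, insertPerm_self]
    refine Prod.ext rfl (Equiv.ext fun i => ?_)
    simpa using congrArg (fun e => e (p.succAbove i)) h
  · simp [Fintype.card_perm, Nat.factorial_succ]

theorem val_succAbove_eq_ite (p : Fin (N + 1)) (i : Fin N) :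
    (p.succAbove i : ℕ) = if (i : ℕ) < p then (i : ℕ) else i + 1 := by
  simp only [Fin.succAbove, Fin.lt_def, Fin.val_castSucc]
  split_ifs <;> simp

theorem succAbove_lt_iff_val_lt (p : Fin (N + 1)) (i : Fin N) :
    p.succAbove i < p ↔ (i : ℕ) < p := by
  rw [Fin.succAbove_lt_iff_castSucc_lt, Fin.lt_def, Fin.val_castSucc]

theorem mem_shuffles {σ : Equiv.Perm (Fin N)} : σ ∈ shuffles N k b ↔
    (∀ i j : Fin N, i < j → (j : ℕ) < k → σ i < σ j) ∧
    (∀ i j : Fin N, k ≤ (i : ℕ) → i < j → (j : ℕ) < k + b → σ i < σ j) ∧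
    (∀ i : Fin N, k + b ≤ (i : ℕ) → σ i = i) := by
  simp [shuffles]

theorem insertPerm_zero_mem_shuffles {σ : Equiv.Perm (Fin N)} :
    insertPerm 0 σ ∈ shuffles (N + 1) (k + 1) b ↔ σ ∈ shuffles N k b := by
  simp only [mem_shuffles, Fin.forall_fin_succ, insertPerm_zero_succ, insertPerm_self,
    Fin.succ_lt_succ_iff, Fin.val_succ, Fin.succ_inj, Fin.val_zero]
  constructor
  · rintro ⟨left, right, rest⟩
    exact ⟨fun i j hij hj => (left.2 i).2 j hij (by omega),
      fun i j hi hij hj => (right.2 i).2 j (by omega) hij (by omega),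
      fun i hi => rest.2 i (by omega)⟩
  · rintro ⟨left, right, rest⟩
    exact ⟨⟨⟨by simp, fun j _ _ => Fin.succ_pos _⟩,
        fun i => ⟨by simp, fun j hij hj => left i j hij (by omega)⟩⟩,
      ⟨⟨by simp, fun j h => by omega⟩,
        fun i => ⟨by simp, fun j hi hij hj => right i j (by omega) hij (by omega)⟩⟩,
      by simp, fun i hi => rest i (by omega)⟩

theorem insertPerm_mem_shuffles (p : Fin (N + 1)) {σ : Equiv.Perm (Fin N)} :
    insertPerm p σ ∈ shuffles (N + 1) p (b + 1) ↔ σ ∈ shuffles N p b := by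
  simp only [mem_shuffles, Fin.forall_iff_succAbove p, insertPerm_self, insertPerm_succAbove,
    Fin.succ_lt_succ_iff, Fin.succAbove_lt_succAbove_iff]
  constructor
  · rintro ⟨left, right, rest⟩
    refine ⟨fun i j hij hj => (left.2 i).2 j hij ?_,
      fun i j hi hij hj => (right.2 i).2 j ?_ hij ?_, fun i hi => ?_⟩
    · rwa [val_succAbove_eq_ite, if_pos hj]
    · rw [val_succAbove_eq_ite]; split_ifs <;> omega
    · rw [val_succAbove_eq_ite]; split_ifs <;> omega
    · have hfix := congrArg Fin.val (rest.2 i (by rw [val_succAbove_eq_ite]; split_ifs <;> omega))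
      rw [val_succAbove_eq_ite, if_neg (by omega), Fin.val_succ] at hfix
      ext; omega
  · rintro ⟨left, right, rest⟩
    refine ⟨⟨⟨by simp, fun j hj hj' => absurd (Fin.lt_def.1 hj) (by omega)⟩,
        fun i => ⟨fun _ h => by omega, fun j hij hj => left i j hij ?_⟩⟩,
      ⟨⟨by simp, fun j _ _ _ => Fin.succ_pos _⟩,
        fun i => ⟨fun hi hip _ => absurd (Fin.lt_def.1 hip) (by omega),
          fun j hi hij hj => right i j ?_ hij ?_⟩⟩, fun h => by omega, fun i hi => ?_⟩
    · rw [val_succAbove_eq_ite] at hj; split_ifs at hj <;> omega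
    · rw [val_succAbove_eq_ite] at hi; split_ifs at hi <;> omega
    · rw [val_succAbove_eq_ite] at hj; split_ifs at hj <;> omega
    · rw [val_succAbove_eq_ite] at hi
      have hpi : ¬ (i : ℕ) < p := fun h => by rw [if_pos h] at hi; omega
      rw [if_neg hpi] at hi
      ext
      rw [val_succAbove_eq_ite, if_neg hpi, rest i (by omega), Fin.val_succ]

theorem eq_zero_or_eq_of_insertPerm_mem_shuffles {p : Fin (N + 1)} {σ : Equiv.Perm (Fin N)}
    (h : insertPerm p σ ∈ shuffles (N + 1) k b) :
    ((p : ℕ) = 0 ∧ (0 < k ∨ k + b = 0)) ∨ ((p : ℕ) = k ∧ 0 < b) := by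
  obtain ⟨left, right, rest⟩ := mem_shuffles.1 h
  by_contra! hp
  have not_fixed : (p : ℕ) ≠ 0 → (p : ℕ) < k + b := fun hp0 => by
    by_contra! hpkb
    have hfix := congrArg Fin.val (rest p hpkb)
    rw [insertPerm_self, Fin.val_zero] at hfix
    exact hp0 hfix.symm
  rcases lt_trichotomy (p : ℕ) k with hpk | hpk | hpk
  · simpa using left 0 p (by rw [Fin.lt_def, Fin.val_zero]; omega) hpk
  · omega
  · simpa using right ⟨k, by omega⟩ p le_rfl hpk (not_fixed (by omega))

theorem shuffles_zero_zero (N : ℕ) : shuffles N 0 0 = {1} := by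
  ext σ
  simp [mem_shuffles, Equiv.ext_iff]

variable {M : Type*} [AddCommMonoid M]

open Classical in
theorem sum_shuffles_succ (F : Equiv.Perm (Fin (N + 1)) → M) :
    ∑ σ ∈ shuffles (N + 1) k b, F σ =
      ∑ p : Fin (N + 1), ∑ σ : Equiv.Perm (Fin N),
        if insertPerm p σ ∈ shuffles (N + 1) k b then F (insertPerm p σ) else 0 := by
  rw [← Fintype.sum_prod_type', (insertPerm_bijective N).sum_comp
    (fun σ => if σ ∈ shuffles (N + 1) k b then F σ else 0), Finset.sum_ite_mem, Finset.univ_inter]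

theorem sum_shuffles_succ_zero (F : Equiv.Perm (Fin (N + 1)) → M) :
    ∑ σ ∈ shuffles (N + 1) (k + 1) 0, F σ = ∑ σ ∈ shuffles N k 0, F (insertPerm 0 σ) := by
  rw [sum_shuffles_succ, Finset.sum_eq_single 0]
  · simp only [insertPerm_zero_mem_shuffles, Finset.sum_ite_mem, Finset.univ_inter]
  · intro p _ hp
    refine Finset.sum_eq_zero fun σ _ => if_neg fun h => hp (Fin.ext ?_)
    rcases eq_zero_or_eq_of_insertPerm_mem_shuffles h with h | h
    · exact h.1
    · exact absurd h.2 (lt_irrefl 0)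
  · simp

theorem sum_shuffles_zero_succ (F : Equiv.Perm (Fin (N + 1)) → M) :
    ∑ σ ∈ shuffles (N + 1) 0 (b + 1), F σ = ∑ σ ∈ shuffles N 0 b, F (insertPerm 0 σ) := by
  rw [sum_shuffles_succ, Finset.sum_eq_single 0]
  · have mem_iff := fun σ => insertPerm_mem_shuffles (b := b) (σ := σ) (0 : Fin (N + 1))
    simp only [Fin.val_zero] at mem_iff
    simp only [mem_iff, Finset.sum_ite_mem, Finset.univ_inter]
  · intro p _ hp
    refine Finset.sum_eq_zero fun σ _ => if_neg fun h => hp (Fin.ext ?_)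
    exact (eq_zero_or_eq_of_insertPerm_mem_shuffles h).elim And.left And.left
  · simp

theorem sum_shuffles_succ_succ (hk : k + 1 < N + 1) (F : Equiv.Perm (Fin (N + 1)) → M) :
    ∑ σ ∈ shuffles (N + 1) (k + 1) (b + 1), F σ =
      ∑ σ ∈ shuffles N k (b + 1), F (insertPerm 0 σ) +
        ∑ σ ∈ shuffles N (k + 1) b, F (insertPerm ⟨k + 1, hk⟩ σ) := by
  have mem_iff := fun σ => insertPerm_mem_shuffles (b := b) (σ := σ) ⟨k + 1, hk⟩
  rw [sum_shuffles_succ, Finset.sum_eq_add 0 ⟨k + 1, hk⟩]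
  · simp only [insertPerm_zero_mem_shuffles, mem_iff, Finset.sum_ite_mem, Finset.univ_inter]
  · exact Fin.ne_of_val_ne (Nat.succ_ne_zero k).symm
  · intro p _ hp
    refine Finset.sum_eq_zero fun σ _ => if_neg fun h => ?_
    rcases eq_zero_or_eq_of_insertPerm_mem_shuffles h with h | h
    · exact hp.1 (Fin.ext h.1)
    · exact hp.2 (Fin.ext h.1)
  · simp
  · simp

theorem sum_antidiagonal_succ_of_pascal {s : ℕ} {Q A B : ℕ → ℕ → M}
    (hA : Q (s + 1) 0 = A s 0) (hB : Q 0 (s + 1) = B 0 s)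
    (hAB : ∀ k b, k + b + 1 = s → Q (k + 1) (b + 1) = A k (b + 1) + B (k + 1) b) :
    ∑ p ∈ antidiagonal (s + 1), Q p.1 p.2 =
      ∑ p ∈ antidiagonal s, A p.1 p.2 + ∑ p ∈ antidiagonal s, B p.1 p.2 := by
  cases s with
  | zero => simp [Finset.Nat.sum_antidiagonal_succ, hA, hB, add_comm]
  | succ s =>
    have interior := Finset.sum_congr rfl fun p (hp : p ∈ antidiagonal s) =>
      hAB p.1 p.2 (by rw [mem_antidiagonal.1 hp])
    rw [Finset.sum_add_distrib] at interior
    rw [Finset.Nat.sum_antidiagonal_succ, Finset.Nat.sum_antidiagonal_succ', interior, hA, hB,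
      Finset.Nat.sum_antidiagonal_succ' (f := fun p => A p.1 p.2),
      Finset.Nat.sum_antidiagonal_succ (f := fun p => B p.1 p.2)]
    abel

theorem sum_antidiagonal_sum_range (Q : ℕ → ℕ → M) (s : ℕ) :
    ∑ p ∈ antidiagonal s, ∑ k ∈ Finset.range p.1, Q k p.2 =
      ∑ t ∈ Finset.range s, ∑ p ∈ antidiagonal t, Q p.1 p.2 := by
  induction s with
  | zero => simp
  | succ s ih =>
    rw [Finset.Nat.sum_antidiagonal_succ, Finset.sum_range_succ, ← ih]
    simp [Finset.sum_range_succ, Finset.sum_add_distrib]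

end Shuffles

section ShuffleSums

variable (𝕜 : Type*) [Field 𝕜] {W M : Type*} [AddCommGroup M] [Module 𝕜 M] {N k b : ℕ}

theorem leadingDegree_insertPerm_zero (d : Fin (N + 1) → ℤ) (σ : Equiv.Perm (Fin N)) (k : ℕ) :
    leadingDegree d (insertPerm 0 σ) (k + 1) = d 0 + leadingDegree (d ∘ Fin.succ) σ k := by
  simp [leadingDegree, Fin.sum_univ_succ]

theorem leadingDegree_insertPerm (d : Fin (N + 1) → ℤ) (σ : Equiv.Perm (Fin N))
    (p : Fin (N + 1)) :
    leadingDegree d (insertPerm p σ) p = leadingDegree (d ∘ Fin.succ) σ p := by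
  simp [leadingDegree, Fin.sum_univ_succAbove _ p, succAbove_lt_iff_val_lt]

theorem koszulSign_one (d : Fin N → ℤ) : koszulSign 𝕜 d 1 = 1 := by
  have no_inversion : ∀ i j : Fin N, ¬ (i < j ∧ j < i) := fun i j h => lt_asymm h.1 h.2
  simp [koszulSign, no_inversion]

theorem koszulSign_insertPerm (d : Fin (N + 1) → ℤ) (p : Fin (N + 1)) (σ : Equiv.Perm (Fin N)) :
    koszulSign 𝕜 d (insertPerm p σ) =
      sign 𝕜 (d 0 * leadingDegree (d ∘ Fin.succ) σ p) * koszulSign 𝕜 (d ∘ Fin.succ) σ := by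
  rw [koszulSign, koszulSign, ← sign_add]
  simp only [Fin.sum_univ_succAbove _ p, insertPerm_self, insertPerm_succAbove, Fin.not_lt_zero,
    and_false, if_false, Finset.sum_const_zero, zero_add, Fin.succAbove_lt_succAbove_iff,
    Fin.succ_lt_succ_iff, Finset.sum_add_distrib, succAbove_lt_iff_val_lt, Fin.succ_pos,
    and_true, leadingDegree, mul_comm (d 0), Finset.sum_mul, ite_mul, zero_mul, Function.comp_apply]

theorem ofFn_comp_insertPerm_zero {α : Type*} (u : Fin (N + 1) → α) (σ : Equiv.Perm (Fin N)) :
    List.ofFn (u ∘ insertPerm 0 σ) = u 0 :: List.ofFn ((u ∘ Fin.succ) ∘ σ) := by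
  simp [List.ofFn_succ, Function.comp_def]

theorem ofFn_eq_insertIdx {α : Type*} (u : Fin (N + 1) → α) (p : Fin (N + 1)) :
    List.ofFn u = (List.ofFn fun i => u (p.succAbove i)).insertIdx p (u p) := by
  induction N with
  | zero => simp [Fin.fin_one_eq_zero p]
  | succ N ih =>
    cases p using Fin.cases with
    | zero => simp [List.ofFn_succ]
    | succ p =>
      rw [List.ofFn_succ, ih _ p, List.ofFn_succ, Fin.val_succ, List.insertIdx_succ_cons,
        Fin.succ_succAbove_zero]
      simp only [Fin.succ_succAbove_succ]

theorem ofFn_comp_insertPerm {α : Type*} (u : Fin (N + 1) → α) (p : Fin (N + 1))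
    (σ : Equiv.Perm (Fin N)) :
    List.ofFn (u ∘ insertPerm p σ) = (List.ofFn ((u ∘ Fin.succ) ∘ σ)).insertIdx p (u 0) := by
  rw [ofFn_eq_insertIdx _ p]
  simp [Function.comp_def]

/-- The sum, over all ways of distributing the first `s` letters of a word in this order over a
word `p` and a word `q`, of the signed values `F p q r`, where `r` is the rest of the word. An
interchange of letters of `p` and `q` is signed by the Koszul rule, and so is moving a symbol of
degree `n`, which stands in front of `q`, past the letters of `p`. -/
def wordUnshuffle : ℕ → ℤ → (Word W → Word W → Word W → M) → Word W → M
  | 0, _, F, l => F [] [] l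
  | _ + 1, _, _, [] => 0
  | s + 1, n, F, v :: l =>
    sign 𝕜 (n * v.1) • wordUnshuffle s n (fun p => F (v :: p)) l +
      wordUnshuffle s (n + v.1) (fun p q => F p (v :: q)) l

/-- The summand of `wordUnshuffle` given by a `(k, b)`-shuffle `σ` of the letters `u`. -/
def shuffleTerm (n : ℤ) (F : Word W → Word W → Word W → M) (u : Fin N → ℤ × W) (k b : ℕ)
    (σ : Equiv.Perm (Fin N)) : M :=
  (sign 𝕜 (n * leadingDegree (Prod.fst ∘ u) σ k) * koszulSign 𝕜 (Prod.fst ∘ u) σ) •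
    F ((List.ofFn (u ∘ σ)).take k) (((List.ofFn (u ∘ σ)).drop k).take b)
      ((List.ofFn (u ∘ σ)).drop (k + b))

theorem shuffleTerm_insertPerm_zero (n : ℤ) (F : Word W → Word W → Word W → M)
    (u : Fin (N + 1) → ℤ × W) (k b : ℕ) (σ : Equiv.Perm (Fin N)) :
    shuffleTerm 𝕜 n F u (k + 1) b (insertPerm 0 σ) =
      sign 𝕜 (n * (u 0).1) • shuffleTerm 𝕜 n (fun p => F (u 0 :: p)) (u ∘ Fin.succ) k b σ := by
  have leading_zero : leadingDegree (Prod.fst ∘ u ∘ Fin.succ) σ 0 = 0 := by simp [leadingDegree]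
  simp only [shuffleTerm, leadingDegree_insertPerm_zero, koszulSign_insertPerm,
    ofFn_comp_insertPerm_zero, Fin.val_zero, leading_zero, add_right_comm k 1 b,
    List.take_succ_cons, List.drop_succ_cons, mul_add, sign_add, mul_zero, sign_zero, one_mul,
    smul_smul, mul_assoc, Function.comp_assoc, Function.comp_apply]

theorem drop_insertIdx_self {α : Type*} (a : α) {l : List α} {k : ℕ} (hk : k ≤ l.length) :
    (l.insertIdx k a).drop k = a :: l.drop k := by
  induction k generalizing l with
  | zero => rfl
  | succ k ih =>
    cases l with
    | nil => simp at hk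
    | cons x l => exact ih (Nat.le_of_succ_le_succ hk)

theorem shuffleTerm_insertPerm (n : ℤ) (F : Word W → Word W → Word W → M)
    (u : Fin (N + 1) → ℤ × W) (k : Fin (N + 1)) (b : ℕ) (σ : Equiv.Perm (Fin N)) :
    shuffleTerm 𝕜 n F u k (b + 1) (insertPerm k σ) =
      shuffleTerm 𝕜 (n + (u 0).1) (fun p q => F p (u 0 :: q)) (u ∘ Fin.succ) k b σ := by
  have hk : (k : ℕ) ≤ (List.ofFn (u ∘ Fin.succ ∘ σ)).length := by
    rw [List.length_ofFn]; omega
  have drop_split (l : Word W) : l.drop (k + (b + 1)) = (l.drop k).drop (b + 1) :=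
    List.drop_drop.symm
  simp only [shuffleTerm, leadingDegree_insertPerm, koszulSign_insertPerm, ofFn_comp_insertPerm,
    drop_split, drop_insertIdx_self _ hk, List.take_insertIdx_eq_take_of_le _ _ _ _ le_rfl,
    List.take_succ_cons, List.drop_succ_cons, List.drop_drop, add_mul, sign_add, mul_assoc,
    Function.comp_assoc, Function.comp_apply]

theorem wordUnshuffle_ofFn (n : ℤ) (F : Word W → Word W → Word W → M) {s : ℕ} (hs : s ≤ N)
    (u : Fin N → ℤ × W) :
    wordUnshuffle 𝕜 s n F (List.ofFn u) =
      ∑ p ∈ Finset.HasAntidiagonal.antidiagonal s, ∑ σ ∈ shuffles N p.1 p.2,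
        shuffleTerm 𝕜 n F u p.1 p.2 σ := by
  induction s generalizing N n F with
  | zero =>
    simp [wordUnshuffle, shuffles_zero_zero, shuffleTerm, koszulSign_one, leadingDegree]
  | succ s ih =>
    obtain ⟨N, rfl⟩ := Nat.exists_eq_add_one.2 (Nat.zero_lt_of_lt hs)
    have hsN : s ≤ N := by omega
    rw [List.ofFn_succ, wordUnshuffle, ih _ _ hsN (fun i => u i.succ),
      ih _ _ hsN (fun i => u i.succ), Finset.smul_sum]
    simp only [Finset.smul_sum]
    refine (sum_antidiagonal_succ_of_pascal (Q := fun k b =>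
        ∑ σ ∈ shuffles (N + 1) k b, shuffleTerm 𝕜 n F u k b σ)
      (A := fun k b => ∑ σ ∈ shuffles N k b, sign 𝕜 (n * (u 0).1) •
        shuffleTerm 𝕜 n (fun p => F (u 0 :: p)) (fun i => u i.succ) k b σ)
      (B := fun k b => ∑ σ ∈ shuffles N k b,
        shuffleTerm 𝕜 (n + (u 0).1) (fun p q => F p (u 0 :: q)) (fun i => u i.succ) k b σ)
      ?_ ?_ fun k b hkb => ?_).symm
    · rw [sum_shuffles_succ_zero]
      exact Finset.sum_congr rfl fun σ _ => shuffleTerm_insertPerm_zero 𝕜 n F u s 0 σ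
    · rw [sum_shuffles_zero_succ]
      exact Finset.sum_congr rfl fun σ _ => shuffleTerm_insertPerm 𝕜 n F u 0 s σ
    · rw [sum_shuffles_succ_succ (by omega)]
      exact congrArg₂ _
        (Finset.sum_congr rfl fun σ _ => shuffleTerm_insertPerm_zero 𝕜 n F u k (b + 1) σ)
        (Finset.sum_congr rfl fun σ _ => shuffleTerm_insertPerm 𝕜 n F u ⟨k + 1, _⟩ b σ)

theorem wordConv_eq_wordUnshuffle {A : Type*} [Ring A] [Algebra 𝕜 A] (n : ℤ) (f g : Word W → A)
    (l : Word W) :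
    wordConv 𝕜 n f g l = wordUnshuffle 𝕜 l.length n (fun p q _ => f p * g q) l := by
  induction l generalizing n f g with
  | nil => rfl
  | cons v l ih => rw [wordConv_cons, ih, ih]; rfl

/-- The value of `f` on a word whose letters are those of `p`, the value of `g` on the word formed
by `q` and the next letter, and the remaining letters. -/
def wordInsert (n : ℤ) (f : Word W → M) (g : Word W → W) (p q : Word W) : Word W → M
  | [] => 0
  | x :: w => f (p ++ (wordDegree q + x.1 + n, g (q ++ [x])) :: w)

theorem wordInsert_take_drop (n : ℤ) (f : Word W → M) (g : Word W → W) {l : Word W} {k b : ℕ}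
    (h : k + b < l.length) :
    wordInsert n f g (l.take k) ((l.drop k).take b) (l.drop (k + b)) =
      f (l.take k ++ (wordDegree ((l.drop k).take (b + 1)) + n, g ((l.drop k).take (b + 1))) ::
        l.drop (k + b + 1)) := by
  have take_eq : (l.drop k).take (b + 1) = (l.drop k).take b ++ [l[k + b]] := by
    rw [List.take_add_one, List.getElem?_drop, List.getElem?_eq_getElem h, Option.toList_some]
  rw [List.drop_eq_getElem_cons h, wordInsert, take_eq]
  simp only [wordDegree, List.map_append, List.map_cons, List.map_nil, List.sum_append,
    List.sum_singleton]

theorem wordCirc_eq_sum_wordUnshuffle (n : ℤ) (f : Word W → M)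
    (g : Word W → W) (l : Word W) :
    wordCirc 𝕜 n g f l =
      ∑ s ∈ Finset.range l.length, wordUnshuffle 𝕜 s n (wordInsert n f g) l := by
  induction l generalizing n f g with
  | nil => rfl
  | cons v l ih =>
    rw [wordCirc_cons, ih, ih, List.length_cons, Finset.sum_range_succ', Finset.smul_sum,
      ← Finset.sum_add_distrib]
    have insert_left : (fun p => wordInsert n f g (v :: p)) = wordInsert n (f ∘ List.cons v) g := by
      ext p q w
      cases w <;> rfl
    have insert_right : (fun p q => wordInsert n f g p (v :: q)) =
        wordInsert (n + v.1) f (g ∘ List.cons v) := by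
      ext p q w
      cases w with
      | nil => rfl
      | cons x w => simp [wordInsert, show v.1 + wordDegree q + x.1 + n =
          wordDegree q + x.1 + (n + v.1) by ring]
    simp [wordUnshuffle, insert_left, insert_right, wordInsert]

theorem wordConv_ofFn {A : Type*} [Ring A] [Algebra 𝕜 A] (n : ℤ) (f g : Word W → A)
    (u : Fin N → ℤ × W) :
    wordConv 𝕜 n f g (List.ofFn u) = ∑ p ∈ Finset.HasAntidiagonal.antidiagonal N,
      ∑ σ ∈ shuffles N p.1 p.2, shuffleTerm 𝕜 n (fun p q _ => f p * g q) u p.1 p.2 σ := by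
  rw [wordConv_eq_wordUnshuffle, List.length_ofFn, wordUnshuffle_ofFn 𝕜 n _ le_rfl]

theorem wordCirc_ofFn (n : ℤ) (f : Word W → M) (g : Word W → W)
    (u : Fin N → ℤ × W) :
    wordCirc 𝕜 n g f (List.ofFn u) = ∑ p ∈ Finset.HasAntidiagonal.antidiagonal N,
      ∑ k ∈ Finset.range p.1, ∑ σ ∈ shuffles N k p.2,
        shuffleTerm 𝕜 n (wordInsert n f g) u k p.2 σ := by
  rw [wordCirc_eq_sum_wordUnshuffle, List.length_ofFn,
    Finset.sum_congr rfl fun t ht => wordUnshuffle_ofFn 𝕜 n _ (Finset.mem_range.1 ht).le u,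
    sum_antidiagonal_sum_range fun k b => ∑ σ ∈ shuffles N k b,
      shuffleTerm 𝕜 n (wordInsert n f g) u k b σ]

end ShuffleSums

section Families

variable {W : Type*}

theorem wordDegree_ofFn {N : ℕ} (u : Fin N → ℤ × W) :
    wordDegree (List.ofFn u) = ∑ i, (u i).1 := by
  simp [wordDegree, List.map_ofFn, List.sum_ofFn]

variable [AddCommGroup W]

/-- The letters of a word without their degrees, as a sequence that is continued by zeros. -/
def letters (l : Word W) (i : ℕ) : W := (l.getD i 0).2

theorem letters_append_cons {k : ℕ} {p : Word W} (hp : p.length = k) (x : ℤ × W) (w : Word W)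
    (t : ℕ) : letters (p ++ x :: w) t =
      if t < k then letters p t else if t = k then x.2 else letters w (t - k - 1) := by
  subst hp
  simp only [letters, List.getD_eq_getElem?_getD]
  split_ifs with hlt heq
  · rw [List.getElem?_append_left hlt]
  · subst heq; simp
  · rw [List.getElem?_append_right (by omega), List.getElem?_cons, if_neg (by omega)]

theorem letters_take (l : Word W) {m r : ℕ} (h : r < m) :
    letters (l.take m) r = letters l r := by
  simp [letters, h]

theorem letters_drop (l : Word W) (m r : ℕ) : letters (l.drop m) r = letters l (m + r) := by
  simp [letters]

theorem letters_ofFn {N i : ℕ} (u : Fin N → ℤ × W) (h : i < N) :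
    letters (List.ofFn u) i = (u ⟨i, h⟩).2 := by
  simp [letters, h]

theorem letters_take_append_cons_drop {l : Word W} {k : ℕ} (hk : k ≤ l.length) (x : ℤ × W)
    (b t : ℕ) : letters (l.take k ++ x :: l.drop (k + b + 1)) t =
      if t < k then letters l t else if t = k then x.2 else letters l (t + b) := by
  rw [letters_append_cons (List.length_take_of_le hk), letters_drop]
  split_ifs with hlt heq
  · exact letters_take l hlt
  · rfl
  · congr 1
    omega

theorem letters_append_cons_eq_update {a : ℕ} (p w : Word W) (d : ℤ) (h : p.length < a) (x : W) :
    (fun i : Fin a => letters (p ++ (d, x) :: w) i) =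
      Function.update (fun i : Fin a => letters (p ++ (d, 0) :: w) i) ⟨p.length, h⟩ x := by
  funext i
  simp only [letters_append_cons rfl, Function.update_apply, Fin.ext_iff]
  split_ifs <;> first | rfl | omega

variable {𝕜 : Type*} [Field 𝕜] [Module 𝕜 W]

theorem isHomogeneousWord_ofFn {𝒲 : ℤ → Submodule 𝕜 W} {N : ℕ} {u : Fin N → ℤ × W} :
    IsHomogeneousWord 𝒲 (List.ofFn u) ↔ ∀ i, (u i).2 ∈ 𝒲 (u i).1 := by
  simp [IsHomogeneousWord, List.mem_ofFn]

variable {M : Type*} [AddCommGroup M] [Module 𝕜 M]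

/-- The map on words given by a family of multilinear maps, one for every length. -/
def familyEval : ((a : ℕ) → MultilinearMap 𝕜 (fun _ : Fin a => W) M) →ₗ[𝕜] Word W → M where
  toFun f l := f l.length fun i => letters l i
  map_add' _ _ := rfl
  map_smul' _ _ := rfl

theorem familyEval_of_length_eq (f : (a : ℕ) → MultilinearMap 𝕜 (fun _ : Fin a => W) M)
    {l : Word W} {a : ℕ} (h : l.length = a) : familyEval f l = f a fun i => letters l i := by
  subst h; rfl

theorem familyEval_ofFn (f : (a : ℕ) → MultilinearMap 𝕜 (fun _ : Fin a => W) M) {a : ℕ}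
    (u : Fin a → ℤ × W) : familyEval f (List.ofFn u) = f a fun i => (u i).2 := by
  rw [familyEval_of_length_eq f List.length_ofFn]
  exact congrArg (f a) (funext fun i => letters_ofFn u i.2)

theorem familyEval_mem_wordLinear (f : (a : ℕ) → MultilinearMap 𝕜 (fun _ : Fin a => W) M) :
    familyEval f ∈ wordLinear 𝕜 W M := by
  intro p d w
  have hlt : p.length < p.length + (w.length + 1) := by omega
  have eval_eq (x : W) : familyEval f (p ++ (d, x) :: w) =
      (f _).toLinearMap (fun i => letters (p ++ (d, 0) :: w) i) ⟨p.length, hlt⟩ x := by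
    rw [familyEval_of_length_eq f (a := p.length + (w.length + 1)) (by simp),
      letters_append_cons_eq_update p w d hlt]
    rfl
  simp only [eval_eq]
  exact LinearMap.isLinear _

end Families

section LeibnizCochains

variable {𝕜 : Type u} [Field 𝕜] {W : Type v} [AddCommGroup W] [Module 𝕜 W]

/-- A cochain on the reduced tensor module, extended by zero to the empty tensors. -/
def extendByZero :
    LeibnizCochain 𝕜 W →ₗ[𝕜] (a : ℕ) → MultilinearMap 𝕜 (fun _ : Fin a => W) W :=
  LinearMap.pi fun
    | 0 => 0
    | a + 1 => LinearMap.proj a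

/-- The map on words given by a cochain on the reduced tensor module. -/
def wordEval : LeibnizCochain 𝕜 W →ₗ[𝕜] Word W → W := familyEval ∘ₗ extendByZero

theorem wordEval_of_length_eq (f : LeibnizCochain 𝕜 W) {l : Word W} {a : ℕ}
    (h : l.length = a + 1) : wordEval f l = f a fun i => letters l i :=
  familyEval_of_length_eq (extendByZero f) h

theorem wordEval_ofFn (f : LeibnizCochain 𝕜 W) {a : ℕ} (u : Fin (a + 1) → ℤ × W) :
    wordEval f (List.ofFn u) = f a fun i => (u i).2 := familyEval_ofFn (extendByZero f) u

@[simp] theorem wordEval_nil (f : LeibnizCochain 𝕜 W) : wordEval f [] = 0 := rfl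

theorem wordEval_mem_wordLinear (f : LeibnizCochain 𝕜 W) : wordEval f ∈ wordLinear 𝕜 W W :=
  familyEval_mem_wordLinear _

theorem exists_eq_ofFn {α : Type*} (l : List α) : ∃ (N : ℕ) (u : Fin N → α), l = List.ofFn u :=
  ⟨l.length, l.get, (List.ofFn_get l).symm⟩

theorem multilinearMap_ext_of_homogeneous {M : Type*} [AddCommGroup M] [Module 𝕜 M]
    (𝒲 : ℤ → Submodule 𝕜 W) [DirectSum.Decomposition 𝒲] {r : ℕ}
    {f g : MultilinearMap 𝕜 (fun _ : Fin r => W) M}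
    (h : ∀ (d : Fin r → ℤ) (v : Fin r → W), (∀ i, v i ∈ 𝒲 (d i)) → f v = g v) : f = g := by
  classical
  ext v
  have hv : v = fun i => ∑ j ∈ (DirectSum.decompose 𝒲 (v i)).support,
      ((DirectSum.decompose 𝒲 (v i) j : 𝒲 j) : W) :=
    funext fun i => (DirectSum.sum_support_decompose 𝒲 (v i)).symm
  rw [hv, MultilinearMap.map_sum_finset, MultilinearMap.map_sum_finset]
  exact Finset.sum_congr rfl fun d _ => h d _ fun i => SetLike.coe_mem _

theorem familyEval_ext_of_homogeneous {M : Type*} [AddCommGroup M] [Module 𝕜 M]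
    (𝒲 : ℤ → Submodule 𝕜 W) [DirectSum.Decomposition 𝒲]
    {f g : (a : ℕ) → MultilinearMap 𝕜 (fun _ : Fin a => W) M}
    (h : ∀ l, IsHomogeneousWord 𝒲 l → familyEval f l = familyEval g l) : f = g := by
  funext a
  refine multilinearMap_ext_of_homogeneous 𝒲 fun d v hv => ?_
  simpa only [familyEval_ofFn] using
    h (List.ofFn fun i => (d i, v i)) (isHomogeneousWord_ofFn.2 hv)

theorem leibnizCochain_ext_of_homogeneous (𝒲 : ℤ → Submodule 𝕜 W) [DirectSum.Decomposition 𝒲]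
    {f g : LeibnizCochain 𝕜 W}
    (h : ∀ l, IsHomogeneousWord 𝒲 l → wordEval f l = wordEval g l) : f = g := by
  have extensions_eq := familyEval_ext_of_homogeneous 𝒲 h
  exact funext fun a => congrFun extensions_eq (a + 1)

theorem wordEval_mem_homogeneousWordMap_iff {𝒲 : ℤ → Submodule 𝕜 W} {n : ℤ}
    {f : LeibnizCochain 𝕜 W} : wordEval f ∈ homogeneousWordMap 𝒲 𝒲 n ↔ f ∈ CLV 𝒲 n := by
  constructor
  · intro h a d v hv
    simpa only [wordEval_ofFn, wordDegree_ofFn] using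
      h (List.ofFn fun i => (d i, v i)) (isHomogeneousWord_ofFn.2 hv)
  · intro h l hl
    obtain ⟨N, u, rfl⟩ := exists_eq_ofFn l
    cases N with
    | zero => simp
    | succ N =>
      rw [wordEval_ofFn, wordDegree_ofFn]
      exact h N (fun i => (u i).1) (fun i => (u i).2) (isHomogeneousWord_ofFn.1 hl)

theorem insertFun_eq_wordInsert (n : ℤ) (f g : LeibnizCochain 𝕜 W) {a b : ℕ} (k : Fin (a + 1))
    (u : Fin (a + b + 1) → ℤ × W) :
    insertFun (f a) (g b) k (fun i => (u i).2) =
      wordInsert n (wordEval f) (wordEval g) ((List.ofFn u).take k)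
        (((List.ofFn u).drop k).take b) ((List.ofFn u).drop (k + b)) := by
  have hk := k.2
  have length_ofFn : (List.ofFn u).length = a + b + 1 := List.length_ofFn
  rw [wordInsert_take_drop n _ _ (by omega), insertFun, wordEval_of_length_eq f (a := a)
    (by
      simp only [List.length_append, List.length_cons, List.length_take, List.length_drop]
      omega),
    wordEval_of_length_eq g (a := b) (by rw [List.length_take, List.length_drop]; omega)]
  refine congrArg (f a) (funext fun t => ?_)
  have ht := t.2
  rw [letters_take_append_cons_drop (by omega)]
  simp only [Fin.ext_iff]
  split_ifs with hlt heq
  · exact (letters_ofFn u (by omega)).symm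
  · refine congrArg (g b) (funext fun r => ?_)
    rw [letters_take _ r.2, letters_drop, letters_ofFn u (by omega)]
  · exact (letters_ofFn u (by omega)).symm

theorem leadingDegree_emod_two {N : ℕ} {d d' : Fin N → ℤ} (h : ∀ i, d i % 2 = d' i % 2)
    (σ : Equiv.Perm (Fin N)) (k : ℕ) :
    leadingDegree d σ k % 2 = leadingDegree d' σ k % 2 := by
  refine Int.ModEq.sum fun i _ => ?_
  split_ifs
  exacts [h _, rfl]

theorem koszulSign_congr {N : ℕ} {d d' : Fin N → ℤ} (h : ∀ i, d i % 2 = d' i % 2)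
    (σ : Equiv.Perm (Fin N)) : koszulSign 𝕜 d σ = koszulSign 𝕜 d' σ := by
  refine sign_congr (Int.ModEq.sum fun i _ => Int.ModEq.sum fun j _ => ?_)
  split_ifs
  exacts [Int.ModEq.mul (h _) (h _), rfl]

variable {𝒲 : ℤ → Submodule 𝕜 W} [DirectSum.Decomposition 𝒲]

theorem circComponent_apply (n : ℤ) (f g : LeibnizCochain 𝕜 W) {a b s : ℕ} (h : a + b = s)
    (u : Fin (s + 1) → ℤ × W) (hu : ∀ i, (u i).2 ∈ 𝒲 (u i).1) :
    ((circComponent 𝒲 n (f a) (g b)).domDomCongr (finCongr (congrArg (· + 1) h)))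
      (fun i => (u i).2) = ∑ k ∈ Finset.range (a + 1), ∑ σ ∈ shuffles (s + 1) k b,
        shuffleTerm 𝕜 n (wordInsert n (wordEval f) (wordEval g)) u k b σ := by
  subst h
  rw [MultilinearMap.domDomCongr_apply, circComponent]
  simp only [finCongr_refl, Equiv.refl_apply]
  rw [homogeneousGlue_apply 𝒲 _ _ (fun i => (u i).1) _ hu]
  · rw [Finset.sum_range]
    simp only [sum_apply, smul_apply]
    refine Finset.sum_congr rfl fun k _ => Finset.sum_congr rfl fun σ _ => ?_
    exact congrArg _ (insertFun_eq_wordInsert n f g k (u ∘ σ))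
  · intro d d' h
    refine Finset.sum_congr rfl fun k _ => Finset.sum_congr rfl fun σ _ => ?_
    rw [koszulSign_congr h,
      sign_congr (𝕜 := 𝕜) (Int.ModEq.mul_left n (leadingDegree_emod_two h σ k))]

theorem wordEval_circ (n : ℤ) (f g : LeibnizCochain 𝕜 W) {l : Word W}
    (hl : IsHomogeneousWord 𝒲 l) :
    wordEval (circ 𝒲 n f g) l = wordCirc 𝕜 n (wordEval g) (wordEval f) l := by
  obtain ⟨N, u, rfl⟩ := exists_eq_ofFn l
  cases N with
  | zero => simp
  | succ s =>
    have component_apply := fun (p : {p // p ∈ Finset.HasAntidiagonal.antidiagonal s}) =>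
      circComponent_apply n f g (Finset.HasAntidiagonal.mem_antidiagonal.1 p.2) u
        (isHomogeneousWord_ofFn.1 hl)
    rw [wordEval_ofFn, circ, sum_apply, Finset.sum_congr rfl fun p _ => component_apply p,
      Finset.sum_attach _ fun p : ℕ × ℕ => ∑ k ∈ Finset.range (p.1 + 1),
        ∑ σ ∈ shuffles (s + 1) k p.2,
          shuffleTerm 𝕜 n (wordInsert n (wordEval f) (wordEval g)) u k p.2 σ,
      wordCirc_ofFn, Finset.Nat.sum_antidiagonal_succ, Finset.sum_range_zero, zero_add]

theorem wordEval_balavoineBracket (m n : ℤ) (f g : LeibnizCochain 𝕜 W) {l : Word W}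
    (hl : IsHomogeneousWord 𝒲 l) :
    wordEval (balavoineBracket 𝒲 m n f g) l = wordBracket 𝕜 m n (wordEval f) (wordEval g) l := by
  simp only [balavoineBracket, map_sub, map_smul, wordBracket, Pi.sub_apply, Pi.smul_apply,
    wordEval_circ _ _ _ hl]

theorem balavoineBracket_antisymm (m n : ℤ) (f g : LeibnizCochain 𝕜 W) :
    balavoineBracket 𝒲 m n f g = -(sign 𝕜 (m * n) • balavoineBracket 𝒲 n m g f) := by
  rw [balavoineBracket, balavoineBracket, smul_sub, smul_smul, mul_comm n m, sign_mul_self]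
  module

theorem isLinearMap_balavoineBracket_right (m n : ℤ) (f : LeibnizCochain 𝕜 W) :
    IsLinearMap 𝕜 fun g => balavoineBracket 𝒲 m n f g := by
  have linear_left := isLinearMap_wordCirc_left (wordEval_mem_wordLinear f)
  constructor
  · refine fun g g' => leibnizCochain_ext_of_homogeneous 𝒲 fun l hl => ?_
    simp only [map_add, Pi.add_apply, wordEval_balavoineBracket _ _ _ _ hl, wordBracket,
      Pi.sub_apply, Pi.smul_apply, (linear_left n l).map_add]
    module
  · refine fun c g => leibnizCochain_ext_of_homogeneous 𝒲 fun l hl => ?_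
    simp only [map_smul, wordEval_balavoineBracket _ _ _ _ hl, wordBracket,
      Pi.sub_apply, Pi.smul_apply, (linear_left n l).map_smul]
    module

theorem isLinearMap_balavoineBracket_left (m n : ℤ) (g : LeibnizCochain 𝕜 W) :
    IsLinearMap 𝕜 fun f => balavoineBracket 𝒲 m n f g := by
  simp only [fun f => balavoineBracket_antisymm (𝒲 := 𝒲) m n f g]
  exact (-(sign 𝕜 (m * n) • (isLinearMap_balavoineBracket_right n m g).mk' _)).isLinear

theorem balavoineBracket_mem_CLV {m n : ℤ} {f g : LeibnizCochain 𝕜 W} (hf : f ∈ CLV 𝒲 m)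
    (hg : g ∈ CLV 𝒲 n) : balavoineBracket 𝒲 m n f g ∈ CLV 𝒲 (m + n) := by
  rw [← wordEval_mem_homogeneousWordMap_iff] at hf hg ⊢
  intro l hl
  rw [wordEval_balavoineBracket _ _ _ _ hl]
  exact wordBracket_mem_homogeneousWordMap hf hg l hl

theorem balavoineBracket_jacobi {m n p : ℤ} {f g h : LeibnizCochain 𝕜 W} (hf : f ∈ CLV 𝒲 m)
    (hg : g ∈ CLV 𝒲 n) (hh : h ∈ CLV 𝒲 p) :
    balavoineBracket 𝒲 m (n + p) f (balavoineBracket 𝒲 n p g h) =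
      balavoineBracket 𝒲 (m + n) p (balavoineBracket 𝒲 m n f g) h +
        sign 𝕜 (m * n) • balavoineBracket 𝒲 n (m + p) g (balavoineBracket 𝒲 m p f h) := by
  refine leibnizCochain_ext_of_homogeneous 𝒲 fun l hl => ?_
  have eval_right {m n p : ℤ} {f g h : LeibnizCochain 𝕜 W} (hf : f ∈ CLV 𝒲 m)
      (hg : g ∈ CLV 𝒲 n) (hh : h ∈ CLV 𝒲 p) :
      wordBracket 𝕜 m (n + p) (wordEval f) (wordEval (balavoineBracket 𝒲 n p g h)) l =
        wordBracket 𝕜 m (n + p) (wordEval f) (wordBracket 𝕜 n p (wordEval g) (wordEval h)) l :=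
    wordBracket_congr_of_isHomogeneousWord (wordEval_mem_homogeneousWordMap_iff.2 hf)
      (wordEval_mem_homogeneousWordMap_iff.2 (balavoineBracket_mem_CLV hg hh)) (fun _ _ => rfl)
      (fun l => wordEval_balavoineBracket n p g h) hl
  have eval_left :
      wordBracket 𝕜 (m + n) p (wordEval (balavoineBracket 𝒲 m n f g)) (wordEval h) l =
        wordBracket 𝕜 (m + n) p (wordBracket 𝕜 m n (wordEval f) (wordEval g)) (wordEval h) l :=
    wordBracket_congr_of_isHomogeneousWord
      (wordEval_mem_homogeneousWordMap_iff.2 (balavoineBracket_mem_CLV hf hg))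
      (wordEval_mem_homogeneousWordMap_iff.2 hh)
      (fun l => wordEval_balavoineBracket m n f g) (fun _ _ => rfl) hl
  simp only [map_add, map_smul, Pi.add_apply, Pi.smul_apply, wordEval_balavoineBracket _ _ _ _ hl]
  rw [eval_right hf hg hh, eval_right hg hf hh, eval_left]
  exact congrFun (wordBracket_jacobi (wordEval_mem_wordLinear f) (wordEval_mem_wordLinear g)
    (wordEval_mem_wordLinear h) m n p) l

variable (𝒲) in
theorem isGradedLieAlgebra_CLV : IsGradedLieAlgebra (CLV 𝒲) (balavoineBracket 𝒲) where
  mem _ _ _ hf _ hg := balavoineBracket_mem_CLV hf hg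
  add_left m n f _ f' _ g _ := (isLinearMap_balavoineBracket_left m n g).map_add f f'
  smul_left m n c f _ g _ := (isLinearMap_balavoineBracket_left m n g).map_smul c f
  add_right m n f _ g _ g' _ := (isLinearMap_balavoineBracket_right m n f).map_add g g'
  smul_right m n c f _ g _ := (isLinearMap_balavoineBracket_right m n f).map_smul c g
  antisymm m n f _ g _ := balavoineBracket_antisymm m n f g
  jacobi _ _ _ _ hf _ hg _ hh := balavoineBracket_jacobi hf hg hh

end LeibnizCochains

section Gluing

theorem ofFn_update {W : Type*} {N : ℕ} (d : Fin N → ℤ) (v : Fin N → W) (i : Fin N) (x : W) :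
    (List.ofFn fun j => (d j, Function.update v i x j)) =
      (List.ofFn fun j => (d j, v j)).take i ++
        (d i, x) :: (List.ofFn fun j => (d j, v j)).drop (i + 1) := by
  rw [← List.set_eq_take_append_cons_drop.trans (if_pos (by simp))]
  refine List.ext_getElem (by simp) fun j hj _ => ?_
  simp only [List.getElem_ofFn, List.getElem_set, Function.update_apply, Fin.ext_iff]
  split_ifs <;> grind

variable {𝕜 : Type u} [Field 𝕜] {W M : Type v} [AddCommGroup W] [Module 𝕜 W]
  [AddCommGroup M] [Module 𝕜 M]

/-- The multilinear map given by a map on words that is linear in every letter, when the degrees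
of the letters are fixed. -/
def multilinearOfDegrees {f : Word W → M} (hf : f ∈ wordLinear 𝕜 W M) {N : ℕ} (d : Fin N → ℤ) :
    MultilinearMap 𝕜 (fun _ : Fin N => W) M where
  toFun v := f (List.ofFn fun i => (d i, v i))
  map_update_add' := fun {inst} v i x y => by
    rw [Subsingleton.elim inst (instDecidableEqFin _), ofFn_update, ofFn_update, ofFn_update]
    exact (hf _ _ _).map_add x y
  map_update_smul' := fun {inst} v i c x => by
    rw [Subsingleton.elim inst (instDecidableEqFin _), ofFn_update, ofFn_update]
    exact (hf _ _ _).map_smul c x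

/-- Letters with the same vector and degrees of the same parity. The components of a cochain do
not see the degrees of its arguments, and the signs see only their parities. -/
def SameParity (v v' : ℤ × W) : Prop := v.1 % 2 = v'.1 % 2 ∧ v.2 = v'.2

theorem familyEval_congr (f : (a : ℕ) → MultilinearMap 𝕜 (fun _ : Fin a => W) M) {l l' : Word W}
    (h : List.Forall₂ SameParity l l') : familyEval f l = familyEval f l' := by
  rw [familyEval_of_length_eq f h.length_eq, familyEval_of_length_eq f rfl]
  refine congrArg (f l'.length) (funext fun i => ?_)
  rw [letters, letters, List.getD_eq_getElem _ _ (i.2.trans_eq h.length_eq.symm),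
    List.getD_eq_getElem _ _ i.2]
  exact (h.get _ i.2).2

theorem exists_familyEval_eq (𝒲 : ℤ → Submodule 𝕜 W) [DirectSum.Decomposition 𝒲]
    {f : Word W → M} (hf : f ∈ wordLinear 𝕜 W M)
    (parity : ∀ l l', List.Forall₂ SameParity l l' → f l = f l') :
    ∃ F : (a : ℕ) → MultilinearMap 𝕜 (fun _ : Fin a => W) M,
      ∀ l, IsHomogeneousWord 𝒲 l → familyEval F l = f l := by
  refine ⟨fun a => homogeneousGlue 𝒲 fun d : Fin a → ℤ => multilinearOfDegrees hf d,
    fun l hl => ?_⟩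
  obtain ⟨N, u, rfl⟩ := exists_eq_ofFn l
  rw [familyEval_ofFn,
    homogeneousGlue_apply 𝒲 _ _ (fun i => (u i).1) _ (isHomogeneousWord_ofFn.1 hl)]
  · rfl
  · intro d d' hd
    ext v
    refine parity _ _ (List.forall₂_iff_get.2 ⟨by simp, fun i hi _ => ?_⟩)
    simpa [SameParity] using hd ⟨i, by simpa using hi⟩

end Gluing

section Derivations

theorem mem_span_singleton_of_tmul_add_smul_tmul_eq_zero {𝕜 V : Type*} [Field 𝕜] [AddCommGroup V]
    [Module 𝕜 V] {x z : V} {c : 𝕜} (hx : x ≠ 0) (h : z ⊗ₜ[𝕜] x + c • x ⊗ₜ[𝕜] z = 0) :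
    z ∈ Submodule.span 𝕜 {x} := by
  by_contra hz
  obtain ⟨ℓ, ℓ_z, ker⟩ := Submodule.exists_le_ker_of_notMem hz
  have ℓ_x : ℓ x = 0 := ker (Submodule.mem_span_singleton_self x)
  have contracted := congrArg (TensorProduct.lid 𝕜 V ∘ LinearMap.rTensor V ℓ) h
  simp [ℓ_x, ℓ_z, hx] at contracted

theorem tmul_self_ne_zero {𝕜 V : Type*} [Field 𝕜] [AddCommGroup V] [Module 𝕜 V] {x : V}
    (hx : x ≠ 0) : x ⊗ₜ[𝕜] x ≠ 0 := by
  obtain ⟨ℓ, ℓ_x, -⟩ := Submodule.exists_le_ker_of_notMem (p := (⊥ : Submodule 𝕜 V)) (by simpa)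
  intro h
  have contracted := congrArg (TensorProduct.lid 𝕜 V ∘ LinearMap.rTensor V ℓ) h
  simp [ℓ_x, hx] at contracted

variable {𝕜 : Type u} [Field 𝕜] {V : Type v} [AddCommGroup V] [Module 𝕜 V]

/-- The endomorphisms of degree `e` of a graded space. -/
def homogeneousEnd (𝒱 : ℤ → Submodule 𝕜 V) (e : ℤ) : Submodule 𝕜 (Module.End 𝕜 V) where
  carrier := {φ | ∀ c, ∀ x ∈ 𝒱 c, φ x ∈ 𝒱 (c + e)}
  zero_mem' := fun _ _ _ => Submodule.zero_mem _
  add_mem' := fun hf hg c x hx => Submodule.add_mem _ (hf c x hx) (hg c x hx)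
  smul_mem' := fun r _ hf c x hx => Submodule.smul_mem _ r (hf c x hx)

theorem mul_mem_homogeneousEnd {𝒱 : ℤ → Submodule 𝕜 V} (i j : ℤ) (φ : Module.End 𝕜 V)
    (hφ : φ ∈ homogeneousEnd 𝒱 i) (ψ : Module.End 𝕜 V) (hψ : ψ ∈ homogeneousEnd 𝒱 j) :
    φ * ψ ∈ homogeneousEnd 𝒱 (i + j) := fun c x hx => by
  rw [show c + (i + j) = c + j + i by ring]
  exact hφ _ _ (hψ c x hx)

variable (𝒱 : ℤ → Submodule 𝕜 V) [DirectSum.Decomposition 𝒱]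

/-- The extension of an endomorphism of degree `e` of `V` to a graded derivation on `V ⊗ V`: this
is `leibnizExt` without arguments from `V ⊗ V`. -/
def derExt (e : ℤ) : Module.End 𝕜 V →ₗ[𝕜] Module.End 𝕜 (V ⊗[𝕜] V) where
  toFun φ := leibnizExt 𝒱 e (MultilinearMap.constOfIsEmpty 𝕜 _ φ) Fin.elim0
  map_add' φ ψ := by rw [← add_apply, ← leibnizExt_add]; rfl
  map_smul' c φ := by rw [RingHom.id_apply, ← smul_apply, ← leibnizExt_smul]; rfl

theorem derExt_tmul (e : ℤ) (φ : Module.End 𝕜 V) {c : ℤ} {x : V} (hx : x ∈ 𝒱 c) (y : V) :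
    derExt 𝒱 e φ (x ⊗ₜ[𝕜] y) = φ x ⊗ₜ[𝕜] y + sign 𝕜 (c * e) • x ⊗ₜ[𝕜] φ y := by
  refine (leibnizExt_apply 𝒱 e (MultilinearMap.constOfIsEmpty 𝕜 _ φ) Fin.elim0 c Fin.elim0
    x y (fun i => i.elim0) hx).trans ?_
  simp

variable {𝒱} in
theorem tensorEnd_ext_of_homogeneous {α β : Module.End 𝕜 (V ⊗[𝕜] V)}
    (h : ∀ i, ∀ x ∈ 𝒱 i, ∀ y, α (x ⊗ₜ[𝕜] y) = β (x ⊗ₜ[𝕜] y)) : α = β :=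
  TensorProduct.ext <| DirectSum.decompose_lhom_ext 𝒱 fun i => LinearMap.ext fun x =>
    LinearMap.ext fun y => h i x x.2 y

theorem leibnizExt_eq_derExt (q : ℤ) {a : ℕ}
    (φ : MultilinearMap 𝕜 (fun _ : Fin a => V ⊗[𝕜] V) (V →ₗ[𝕜] V)) (d : Fin a → ℤ)
    (X : Fin a → V ⊗[𝕜] V) (hX : ∀ i, X i ∈ tensorGrading 𝒱 (d i)) :
    leibnizExt 𝒱 q φ X = derExt 𝒱 (∑ i, d i + q) (φ X) := by
  refine tensorEnd_ext_of_homogeneous (𝒱 := 𝒱) fun c x hx y => ?_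
  rw [leibnizExt_apply 𝒱 q φ d c X x y hX hx, derExt_tmul 𝒱 _ _ hx]

theorem derExt_commutator (i j : ℤ) (φ : Module.End 𝕜 V) (hφ : φ ∈ homogeneousEnd 𝒱 i)
    (ψ : Module.End 𝕜 V) (hψ : ψ ∈ homogeneousEnd 𝒱 j) :
    derExt 𝒱 i φ * derExt 𝒱 j ψ - sign 𝕜 (i * j) • (derExt 𝒱 j ψ * derExt 𝒱 i φ) =
      derExt 𝒱 (i + j) (φ * ψ - sign 𝕜 (i * j) • (ψ * φ)) := by
  refine tensorEnd_ext_of_homogeneous (𝒱 := 𝒱) fun c x hx y => ?_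
  simp only [LinearMap.sub_apply, LinearMap.smul_apply, Module.End.mul_apply,
    derExt_tmul 𝒱 _ _ hx, map_add, map_smul, derExt_tmul 𝒱 _ _ (hφ c x hx),
    derExt_tmul 𝒱 _ _ (hψ c x hx), TensorProduct.sub_tmul, TensorProduct.tmul_sub,
    ← TensorProduct.smul_tmul', TensorProduct.tmul_smul, mul_add, add_mul, sign_add, mul_comm j i]
  match_scalars <;> grind [sign_mul_self]

theorem derExt_mem {e : ℤ} {φ : Module.End 𝕜 V} (hφ : φ ∈ homogeneousEnd 𝒱 e) {j : ℤ}
    {z : V ⊗[𝕜] V} (hz : z ∈ tensorGrading 𝒱 j) :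
    derExt 𝒱 e φ z ∈ tensorGrading 𝒱 (j + e) := by
  refine Submodule.span_le (p := (tensorGrading 𝒱 (j + e)).comap (derExt 𝒱 e φ)).2 ?_ hz
  rintro _ ⟨i, k, rfl, x, hx, y, hy, rfl⟩
  rw [SetLike.mem_coe, Submodule.mem_comap, derExt_tmul 𝒱 _ _ hx]
  exact Submodule.add_mem _ (tmul_mem_tensorGrading (by ring) (hφ _ _ hx) hy)
    (Submodule.smul_mem _ _ (tmul_mem_tensorGrading (by ring) hx (hφ _ _ hy)))

theorem eq_zero_of_derExt_eq_zero (two_ne_zero : (2 : 𝕜) ≠ 0) {e : ℤ} {φ : Module.End 𝕜 V}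
    (hφ : φ ∈ homogeneousEnd 𝒱 e) (h : derExt 𝒱 e φ = 0) : φ = 0 := by
  refine DirectSum.decompose_lhom_ext 𝒱 fun c => LinearMap.ext fun ⟨x, hx⟩ => ?_
  change φ x = 0
  by_contra hφx
  have hx0 : x ≠ 0 := by rintro rfl; exact hφx (map_zero φ)
  have tmul_eq : φ x ⊗ₜ[𝕜] x + sign 𝕜 (c * e) • x ⊗ₜ[𝕜] φ x = 0 := by
    rw [← derExt_tmul 𝒱 e φ hx, h, LinearMap.zero_apply]
  obtain ⟨r, hr⟩ := Submodule.mem_span_singleton.1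
    (mem_span_singleton_of_tmul_add_smul_tmul_eq_zero hx0 tmul_eq)
  have degree_eq : c = c + e := DirectSum.degree_eq_of_mem_mem 𝒱
    (hr ▸ Submodule.smul_mem _ r hx) (hφ c x hx) hφx
  obtain rfl : e = 0 := by omega
  rw [← hr, mul_zero, sign_zero, one_smul, TensorProduct.tmul_smul, ← TensorProduct.smul_tmul',
    ← add_smul, ← two_mul, smul_eq_zero, mul_eq_zero] at tmul_eq
  obtain ((two_eq | rfl) | self_eq) := tmul_eq
  · exact two_ne_zero two_eq
  · exact hφx (by rw [← hr, zero_smul])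
  · exact tmul_self_ne_zero hx0 self_eq

end Derivations

section TriangularSign

variable (𝕜 : Type*) [Field 𝕜]

/-- The sign `(-1)^{a (a + 1) / 2}`, which is the one of the component `p = a + 1` in `Psi`. -/
def triSign (a : ℕ) : 𝕜 := sign 𝕜 (((a + 1) * a / 2 : ℕ) : ℤ)

@[simp] theorem triSign_mul_self (a : ℕ) : triSign 𝕜 a * triSign 𝕜 a = 1 := sign_mul_self 𝕜 _

theorem triSign_mul (a b : ℕ) :
    triSign 𝕜 a * triSign 𝕜 b = triSign 𝕜 (a + b) * sign 𝕜 (a * b) := by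
  rw [triSign, triSign, triSign, ← sign_add, ← sign_add]
  refine sign_congr ?_
  obtain ⟨x, hx⟩ := (Nat.even_mul_succ_self a).two_dvd
  obtain ⟨y, hy⟩ := (Nat.even_mul_succ_self b).two_dvd
  have sum_eq : (a + b + 1) * (a + b) = 2 * (x + y + a * b) := by linear_combination hx + hy
  rw [mul_comm (a + 1), mul_comm (b + 1), hx, hy, sum_eq]
  simp only [Nat.mul_div_cancel_left _ two_pos]
  push_cast
  omega

end TriangularSign

section LastLetter

variable {𝕜 : Type u} [Field 𝕜] {W : Type v} [AddCommGroup W] [Module 𝕜 W]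

/-- The map on words that applies the endomorphism `F l` to the last letter of `l ++ [z]`. -/
def actOnLast (F : Word W → Module.End 𝕜 W) (l : Word W) : W :=
  if h : l = [] then 0 else F l.dropLast (l.getLast h).2

@[simp] theorem actOnLast_nil (F : Word W → Module.End 𝕜 W) : actOnLast F [] = 0 := rfl

@[simp] theorem actOnLast_append_singleton (F : Word W → Module.End 𝕜 W) (l : Word W)
    (z : ℤ × W) : actOnLast F (l ++ [z]) = F l z.2 := by
  simp [actOnLast]

theorem wordBracket_actOnLast (m n : ℤ) (F G : Word W → Module.End 𝕜 W) (l : Word W)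
    (z : ℤ × W) :
    wordBracket 𝕜 m n (actOnLast F) (actOnLast G) (l ++ [z]) =
      (wordCirc 𝕜 n (actOnLast G) F l - sign 𝕜 (m * n) • wordCirc 𝕜 m (actOnLast F) G l +
        wordConvBracket 𝕜 m n F G l) z.2 := by
  simp only [wordBracket, wordConvBracket, Pi.sub_apply, Pi.smul_apply,
    wordCirc_append_singleton (actOnLast_append_singleton F) (actOnLast_append_singleton G),
    wordCirc_append_singleton (actOnLast_append_singleton G) (actOnLast_append_singleton F),
    LinearMap.add_apply, LinearMap.sub_apply, LinearMap.smul_apply]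
  module

theorem isHomogeneousWord_append_singleton {𝒲 : ℤ → Submodule 𝕜 W} {l : Word W} {z : ℤ × W} :
    IsHomogeneousWord 𝒲 (l ++ [z]) ↔ IsHomogeneousWord 𝒲 l ∧ z.2 ∈ 𝒲 z.1 := by
  simp [IsHomogeneousWord, or_imp, forall_and]

end LastLetter

section NambuCochains

variable {𝕜 : Type u} [Field 𝕜] {V : Type v} [AddCommGroup V] [Module 𝕜 V]

/-- A Nambu cochain as a map from words in `s(V ⊗ V)` to endomorphisms of `V`, with the signs of
`Psi`. -/
def nambuEval (f : NambuCochain 𝕜 V) : Word (V ⊗[𝕜] V) → Module.End 𝕜 V :=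
  familyEval fun a => triSign 𝕜 a • f a

theorem nambuEval_of_length_eq (f : NambuCochain 𝕜 V) {l : Word (V ⊗[𝕜] V)} {a : ℕ}
    (h : l.length = a) : nambuEval f l = triSign 𝕜 a • f a fun i => letters l i :=
  familyEval_of_length_eq _ h

theorem nambuEval_ofFn (f : NambuCochain 𝕜 V) {a : ℕ} (u : Fin a → ℤ × (V ⊗[𝕜] V)) :
    nambuEval f (List.ofFn u) = triSign 𝕜 a • f a fun i => (u i).2 := familyEval_ofFn _ u

theorem nambuEval_mem_wordLinear (f : NambuCochain 𝕜 V) :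
    nambuEval f ∈ wordLinear 𝕜 (V ⊗[𝕜] V) (Module.End 𝕜 V) := familyEval_mem_wordLinear _

theorem isHomogeneousWord_suspTensor_ofFn {𝒱 : ℤ → Submodule 𝕜 V} {a : ℕ} {d : Fin a → ℤ}
    {X : Fin a → V ⊗[𝕜] V} :
    IsHomogeneousWord (suspTensor 𝒱) (List.ofFn fun i => (d i + 1, X i)) ↔
      ∀ i, X i ∈ tensorGrading 𝒱 (d i) := by
  simp [isHomogeneousWord_ofFn, suspension]

theorem nambuEval_mem_homogeneousWordMap_iff {𝒱 : ℤ → Submodule 𝕜 V} {n : ℤ}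
    {f : NambuCochain 𝕜 V} :
    nambuEval f ∈ homogeneousWordMap (suspTensor 𝒱) (homogeneousEnd 𝒱) n ↔ f ∈ CV 𝒱 n := by
  constructor
  · intro h a d c X x hX hx
    have smul_mem := h _ (isHomogeneousWord_suspTensor_ofFn.2 hX) c x hx
    rw [nambuEval_ofFn, wordDegree_ofFn, LinearMap.smul_apply] at smul_mem
    have mem := Submodule.smul_mem _ (triSign 𝕜 a) smul_mem
    rw [smul_smul, triSign_mul_self, one_smul] at mem
    convert mem using 2
    simp only [Finset.sum_add_distrib, Finset.sum_const, Finset.card_univ, Fintype.card_fin,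
      nsmul_eq_mul, mul_one]
    ring
  · intro h l hl c x hx
    obtain ⟨N, u, rfl⟩ := exists_eq_ofFn l
    rw [nambuEval_ofFn, wordDegree_ofFn, LinearMap.smul_apply]
    refine Submodule.smul_mem _ _ ?_
    convert h N (fun i => (u i).1 - 1) c (fun i => (u i).2) x (isHomogeneousWord_ofFn.1 hl) hx
      using 2
    simp only [Finset.sum_sub_distrib, Finset.sum_const, Finset.card_univ, Fintype.card_fin,
      nsmul_eq_mul, mul_one]
    ring

variable (𝒱 : ℤ → Submodule 𝕜 V) [DirectSum.Decomposition 𝒱]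

theorem nambuCochain_ext_of_homogeneous {f g : NambuCochain 𝕜 V}
    (h : ∀ l, IsHomogeneousWord (suspTensor 𝒱) l → nambuEval f l = nambuEval g l) : f = g := by
  have smul_eq := familyEval_ext_of_homogeneous (suspTensor 𝒱) h
  funext a
  exact smul_right_injective _ (left_ne_zero_of_mul_eq_one (triSign_mul_self 𝕜 a))
    (congrFun smul_eq a)

theorem Psi_apply (n : ℤ) (f : NambuCochain 𝕜 V) (a : ℕ) (v : Fin (a + 1) → V ⊗[𝕜] V) :
    Psi 𝒱 n f a v = triSign 𝕜 a •
      leibnizExt 𝒱 (n + a) (f a) (fun i => v i.castSucc) (v (Fin.last a)) := rfl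

theorem wordEval_Psi_append_singleton (n : ℤ) (f : NambuCochain 𝕜 V) {l : Word (V ⊗[𝕜] V)}
    (hl : IsHomogeneousWord (suspTensor 𝒱) l) (z : ℤ × (V ⊗[𝕜] V)) :
    wordEval (Psi 𝒱 n f) (l ++ [z]) = mapByDegree (derExt 𝒱) n (nambuEval f) l z.2 := by
  obtain ⟨N, u, rfl⟩ := exists_eq_ofFn l
  have append_eq : List.ofFn u ++ [z] = List.ofFn (Fin.snoc u z : Fin (N + 1) → _) := by
    rw [List.ofFn_succ']
    simp only [List.concat_eq_append, Fin.snoc_castSucc, Fin.snoc_last]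
  rw [append_eq, wordEval_ofFn, Psi_apply, mapByDegree, nambuEval_ofFn, wordDegree_ofFn, map_smul,
    leibnizExt_eq_derExt 𝒱 _ _ (fun i => (u i).1 - 1) _
      (by simpa only [Fin.snoc_castSucc, suspTensor, suspension] using isHomogeneousWord_ofFn.1 hl)]
  simp

theorem wordEval_Psi_eq_actOnLast (n : ℤ) (f : NambuCochain 𝕜 V) {l : Word (V ⊗[𝕜] V)}
    (hl : IsHomogeneousWord (suspTensor 𝒱) l) :
    wordEval (Psi 𝒱 n f) l = actOnLast (mapByDegree (derExt 𝒱) n (nambuEval f)) l := by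
  cases l using List.reverseRecOn with
  | nil => rfl
  | append_singleton l z =>
    rw [wordEval_Psi_append_singleton 𝒱 n f (isHomogeneousWord_append_singleton.1 hl).1,
      actOnLast_append_singleton]

theorem mapsTo_Psi (n : ℤ) : Set.MapsTo (Psi 𝒱 n) (CV 𝒱 n) (CLV (suspTensor 𝒱) n) := by
  intro f hf
  refine wordEval_mem_homogeneousWordMap_iff.1 fun l hl => ?_
  rw [wordEval_Psi_eq_actOnLast 𝒱 n f hl]
  cases l using List.reverseRecOn with
  | nil => exact Submodule.zero_mem _
  | append_singleton l z =>
    obtain ⟨hl, hz⟩ := isHomogeneousWord_append_singleton.1 hl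
    have degree_eq : wordDegree (l ++ [z]) + n - 1 = z.1 - 1 + (wordDegree l + n) := by
      simp [wordDegree]
      ring
    rw [actOnLast_append_singleton]
    change _ ∈ tensorGrading 𝒱 (wordDegree (l ++ [z]) + n - 1)
    rw [degree_eq]
    exact derExt_mem 𝒱 (nambuEval_mem_homogeneousWordMap_iff.2 hf l hl) hz

variable {𝒱} in
theorem injOn_Psi (two_ne_zero : (2 : 𝕜) ≠ 0) (n : ℤ) : Set.InjOn (Psi 𝒱 n) (CV 𝒱 n) := by
  intro f hf g hg Psi_eq
  refine sub_eq_zero.1 (nambuCochain_ext_of_homogeneous 𝒱 fun l hl => ?_)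
  have sub_mem := nambuEval_mem_homogeneousWordMap_iff.2 (Submodule.sub_mem _ hf hg)
  have derExt_eq_zero : mapByDegree (derExt 𝒱) n (nambuEval (f - g)) l = 0 := by
    refine LinearMap.ext fun z => ?_
    rw [← wordEval_Psi_append_singleton 𝒱 n (f - g) hl (0, z), map_sub, sub_eq_zero.2 Psi_eq,
      map_zero]
    rfl
  rw [eq_zero_of_derExt_eq_zero 𝒱 two_ne_zero (sub_mem l hl) derExt_eq_zero]
  obtain ⟨N, u, rfl⟩ := exists_eq_ofFn l
  simp [nambuEval_ofFn]

end NambuCochains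

section NambuBracket

variable {𝕜 : Type u} [Field 𝕜] {V : Type v} [AddCommGroup V] [Module 𝕜 V]
  (𝒱 : ℤ → Submodule 𝕜 V) [DirectSum.Decomposition 𝒱]

/-- The circle product of Nambu cochains, with `g` of degree `n`, as a map on words: `g` is
inserted either as a derivation of `V ⊗ V`, or by composition of endomorphisms of `V`. -/
def nambuWordCirc (n : ℤ) (f g : NambuCochain 𝕜 V) : Word (V ⊗[𝕜] V) → Module.End 𝕜 V :=
  wordCirc 𝕜 n (wordEval (Psi 𝒱 n g)) (nambuEval f) + wordConv 𝕜 n (nambuEval f) (nambuEval g)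

/-- The bracket of Nambu cochains of degrees `m` and `n` as a map on words. -/
def nambuWordBracket (m n : ℤ) (f g : NambuCochain 𝕜 V) : Word (V ⊗[𝕜] V) → Module.End 𝕜 V :=
  nambuWordCirc 𝒱 n f g - sign 𝕜 (m * n) • nambuWordCirc 𝒱 m g f

theorem nambuWordBracket_mem_wordLinear (m n : ℤ) (f g : NambuCochain 𝕜 V) :
    nambuWordBracket 𝒱 m n f g ∈ wordLinear 𝕜 (V ⊗[𝕜] V) (Module.End 𝕜 V) := by
  have circ_mem (n : ℤ) (f g : NambuCochain 𝕜 V) : nambuWordCirc 𝒱 n f g ∈ wordLinear 𝕜 _ _ :=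
    Submodule.add_mem _
      (wordCirc_mem_wordLinear (nambuEval_mem_wordLinear f) (wordEval_mem_wordLinear _) n)
      (wordConv_mem_wordLinear (nambuEval_mem_wordLinear f) (nambuEval_mem_wordLinear g) n)
  exact Submodule.sub_mem _ (circ_mem n f g) (Submodule.smul_mem _ _ (circ_mem m g f))

variable {𝒱} in
theorem nambuWordBracket_mem_homogeneousWordMap {m n : ℤ} {f g : NambuCochain 𝕜 V}
    (hf : f ∈ CV 𝒱 m) (hg : g ∈ CV 𝒱 n) :
    nambuWordBracket 𝒱 m n f g ∈
      homogeneousWordMap (suspTensor 𝒱) (homogeneousEnd 𝒱) (m + n) := by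
  have circ_mem {m n : ℤ} {f g : NambuCochain 𝕜 V} (hf : f ∈ CV 𝒱 m) (hg : g ∈ CV 𝒱 n) :
      nambuWordCirc 𝒱 n f g ∈ homogeneousWordMap (suspTensor 𝒱) (homogeneousEnd 𝒱) (m + n) := by
    have Psi_mem := wordEval_mem_homogeneousWordMap_iff.2 (mapsTo_Psi 𝒱 n hg)
    rw [← nambuEval_mem_homogeneousWordMap_iff] at hf hg
    exact Submodule.add_mem _ (wordCirc_mem_homogeneousWordMap hf Psi_mem)
      (wordConv_mem_homogeneousWordMap mul_mem_homogeneousEnd hf hg)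
  exact Submodule.sub_mem _ (circ_mem hf hg)
    (Submodule.smul_mem _ _ (add_comm n m ▸ circ_mem hg hf))

theorem wordDegree_emod_two {W : Type*} {l l' : Word W} (h : List.Forall₂ SameParity l l') :
    wordDegree l % 2 = wordDegree l' % 2 := by
  induction h with
  | nil => rfl
  | cons h _ ih =>
    rw [wordDegree_cons, wordDegree_cons]
    exact Int.ModEq.add h.1 ih

theorem nambuWordBracket_congr (m n : ℤ) (f g : NambuCochain 𝕜 V) {l l' : Word (V ⊗[𝕜] V)}
    (h : List.Forall₂ SameParity l l') :
    nambuWordBracket 𝒱 m n f g l = nambuWordBracket 𝒱 m n f g l' := by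
  have circ_congr (n : ℤ) (f g : NambuCochain 𝕜 V) :
      nambuWordCirc 𝒱 n f g l = nambuWordCirc 𝒱 n f g l' := by
    simp only [nambuWordCirc, Pi.add_apply]
    congr 1
    · exact wordCirc_congr (fun _ _ h => h.1) rfl (fun _ _ => familyEval_congr _)
        (fun _ _ _ h => ⟨Int.ModEq.add_right n (wordDegree_emod_two h), familyEval_congr _ h⟩) h
    · exact wordConv_congr (fun _ _ h => h.1) rfl (fun _ _ => familyEval_congr _)
        (fun _ _ => familyEval_congr _) h
  simp only [nambuWordBracket, Pi.sub_apply, Pi.smul_apply, circ_congr]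

variable {𝒱}

theorem wordEval_balavoineBracket_Psi {m n : ℤ} {f g : NambuCochain 𝕜 V} (hf : f ∈ CV 𝒱 m)
    (hg : g ∈ CV 𝒱 n) {l : Word (V ⊗[𝕜] V)} (hl : IsHomogeneousWord (suspTensor 𝒱) l) :
    wordEval (balavoineBracket (suspTensor 𝒱) m n (Psi 𝒱 m f) (Psi 𝒱 n g)) l =
      actOnLast (mapByDegree (derExt 𝒱) (m + n) (nambuWordBracket 𝒱 m n f g)) l := by
  have Psi_f_mem := wordEval_mem_homogeneousWordMap_iff.2 (mapsTo_Psi 𝒱 m hf)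
  have Psi_g_mem := wordEval_mem_homogeneousWordMap_iff.2 (mapsTo_Psi 𝒱 n hg)
  rw [wordEval_balavoineBracket _ _ _ _ hl]
  cases l using List.reverseRecOn with
  | nil => simp [wordBracket]
  | append_singleton l z =>
    have hl' := (isHomogeneousWord_append_singleton.1 hl).1
    have circ_Psi_f := wordCirc_congr_of_isHomogeneousWord (fun _ _ => rfl)
      (fun l _ h => ⟨Psi_f_mem l h, wordEval_Psi_eq_actOnLast 𝒱 m f h⟩) hl' (f := nambuEval g)
    have circ_Psi_g := wordCirc_congr_of_isHomogeneousWord (fun _ _ => rfl)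
      (fun l _ h => ⟨Psi_g_mem l h, wordEval_Psi_eq_actOnLast 𝒱 n g h⟩) hl' (f := nambuEval f)
    rw [wordBracket_congr_of_isHomogeneousWord Psi_f_mem Psi_g_mem
        (fun _ => wordEval_Psi_eq_actOnLast 𝒱 m f) (fun _ => wordEval_Psi_eq_actOnLast 𝒱 n g) hl,
      wordBracket_actOnLast, wordCirc_mapByDegree, wordCirc_mapByDegree,
      wordConvBracket_mapByDegree (derExt_commutator 𝒱)
        (nambuEval_mem_homogeneousWordMap_iff.2 hf) (nambuEval_mem_homogeneousWordMap_iff.2 hg) hl',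
      actOnLast_append_singleton, add_comm n m]
    congr 1
    simp only [mapByDegree, nambuWordBracket, nambuWordCirc, wordConvBracket, Pi.add_apply,
      Pi.sub_apply, Pi.smul_apply, circ_Psi_f, circ_Psi_g, map_add, map_sub, map_smul]
    module

theorem exists_nambuEval_eq_nambuWordBracket (𝒱 : ℤ → Submodule 𝕜 V) [DirectSum.Decomposition 𝒱]
    (m n : ℤ) (f g : NambuCochain 𝕜 V) : ∃ h : NambuCochain 𝕜 V,
      ∀ l, IsHomogeneousWord (suspTensor 𝒱) l → nambuEval h l = nambuWordBracket 𝒱 m n f g l := by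
  obtain ⟨F, F_eq⟩ := exists_familyEval_eq (suspTensor 𝒱)
    (nambuWordBracket_mem_wordLinear 𝒱 m n f g) fun _ _ => nambuWordBracket_congr 𝒱 m n f g
  refine ⟨fun a => triSign 𝕜 a • F a, fun l hl => ?_⟩
  simpa only [nambuEval, smul_smul, triSign_mul_self, one_smul] using F_eq l hl

theorem exists_Psi_eq_balavoineBracket {m n : ℤ} {f g : NambuCochain 𝕜 V} (hf : f ∈ CV 𝒱 m)
    (hg : g ∈ CV 𝒱 n) : ∃ h ∈ CV 𝒱 (m + n),
      Psi 𝒱 (m + n) h = balavoineBracket (suspTensor 𝒱) m n (Psi 𝒱 m f) (Psi 𝒱 n g) ∧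
      ∀ l, IsHomogeneousWord (suspTensor 𝒱) l → nambuEval h l = nambuWordBracket 𝒱 m n f g l := by
  obtain ⟨h, h_eq⟩ := exists_nambuEval_eq_nambuWordBracket 𝒱 m n f g
  refine ⟨h, nambuEval_mem_homogeneousWordMap_iff.1 fun l hl => ?_,
    leibnizCochain_ext_of_homogeneous (suspTensor 𝒱) fun l hl => ?_, h_eq⟩
  · exact h_eq l hl ▸ nambuWordBracket_mem_homogeneousWordMap hf hg l hl
  · rw [wordEval_balavoineBracket_Psi hf hg hl, wordEval_Psi_eq_actOnLast 𝒱 _ h hl]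
    cases l using List.reverseRecOn with
    | nil => rfl
    | append_singleton l z =>
      rw [actOnLast_append_singleton, actOnLast_append_singleton, mapByDegree, mapByDegree,
        h_eq l (isHomogeneousWord_append_singleton.1 hl).1]

theorem courant_mem_CV {m n : ℤ} {f g : NambuCochain 𝕜 V} (hf : f ∈ CV 𝒱 m)
    (hg : g ∈ CV 𝒱 n) : courant 𝒱 m n f g ∈ CV 𝒱 (m + n) :=
  let ⟨h, h_mem, Psi_h, _⟩ := exists_Psi_eq_balavoineBracket hf hg
  Function.invFunOn_mem ⟨h, h_mem, Psi_h⟩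

theorem Psi_courant {m n : ℤ} {f g : NambuCochain 𝕜 V} (hf : f ∈ CV 𝒱 m) (hg : g ∈ CV 𝒱 n) :
    Psi 𝒱 (m + n) (courant 𝒱 m n f g) =
      balavoineBracket (suspTensor 𝒱) m n (Psi 𝒱 m f) (Psi 𝒱 n g) :=
  let ⟨h, h_mem, Psi_h, _⟩ := exists_Psi_eq_balavoineBracket hf hg
  Function.invFunOn_eq ⟨h, h_mem, Psi_h⟩

theorem nambuEval_courant (two_ne_zero : (2 : 𝕜) ≠ 0) {m n : ℤ} {f g : NambuCochain 𝕜 V}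
    (hf : f ∈ CV 𝒱 m) (hg : g ∈ CV 𝒱 n) {l : Word (V ⊗[𝕜] V)}
    (hl : IsHomogeneousWord (suspTensor 𝒱) l) :
    nambuEval (courant 𝒱 m n f g) l = nambuWordBracket 𝒱 m n f g l := by
  obtain ⟨h, h_mem, Psi_h, h_eq⟩ := exists_Psi_eq_balavoineBracket hf hg
  rw [injOn_Psi two_ne_zero (m + n) (courant_mem_CV hf hg) h_mem
    ((Psi_courant hf hg).trans Psi_h.symm), h_eq l hl]

end NambuBracket

section NambuCircleProduct

variable {𝕜 : Type u} [Field 𝕜] {V : Type v} [AddCommGroup V] [Module 𝕜 V]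
  (𝒱 : ℤ → Submodule 𝕜 V) [DirectSum.Decomposition 𝒱]

theorem wordInsert_nambuEval_Psi (n : ℤ) (f g : NambuCochain 𝕜 V) {a b : ℕ} (k : Fin a)
    (u : Fin (a + b) → ℤ × (V ⊗[𝕜] V)) :
    wordInsert n (nambuEval f) (wordEval (Psi 𝒱 n g)) ((List.ofFn u).take k)
        (((List.ofFn u).drop k).take b) ((List.ofFn u).drop (k + b)) =
      (triSign 𝕜 a * triSign 𝕜 b) • f a fun t =>
        if (t : ℕ) < k then (u ⟨t, by omega⟩).2
        else if t = k then
          leibnizExt 𝒱 (n + b) (g b) (fun r => (u ⟨k + r, by omega⟩).2) (u ⟨k + b, by omega⟩).2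
        else (u ⟨t + b, by omega⟩).2 := by
  have hk := k.2
  have length_ofFn : (List.ofFn u).length = a + b := List.length_ofFn
  rw [wordInsert_take_drop n _ _ (by omega), wordEval_of_length_eq _ (a := b)
    (by rw [List.length_take, List.length_drop]; omega), Psi_apply,
    (nambuEval_mem_wordLinear f _ _ _).map_smul, nambuEval_of_length_eq f (a := a)
    (by
      simp only [List.length_append, List.length_cons, List.length_take, List.length_drop]
      omega),
    smul_smul, mul_comm]
  refine congrArg _ (congrArg (f a) (funext fun t => ?_))
  have ht := t.2
  rw [letters_take_append_cons_drop (by omega)]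
  simp only [Fin.ext_iff]
  split_ifs with hlt heq
  · exact letters_ofFn u (by omega)
  · refine congrArg₂ _ (congrArg _ (funext fun r => ?_)) ?_
    · rw [Fin.val_castSucc, letters_take _ (by omega), letters_drop, letters_ofFn u (by omega)]
    · rw [Fin.val_last, letters_take _ (by omega), letters_drop, letters_ofFn u (by omega)]
  · exact letters_ofFn u (by omega)

theorem shuffleTerm_wordInsert_nambuEval (n : ℤ) (f g : NambuCochain 𝕜 V) {a b : ℕ}
    (d : Fin (a + b) → ℤ) (X : Fin (a + b) → V ⊗[𝕜] V) (k : Fin a)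
    {σ : Equiv.Perm (Fin (a + b))} (hσ : σ ∈ shuffles (a + b) k b) :
    shuffleTerm 𝕜 n (wordInsert n (nambuEval f) (wordEval (Psi 𝒱 n g)))
        (fun i => (d i + 1, X i)) k b σ =
      (triSign 𝕜 a * triSign 𝕜 b) •
        (sign 𝕜 (n * leadingDegree (fun i => d i + 1) σ k) *
            koszulSign 𝕜 (fun i => d i + 1) σ) •
          f a fun t =>
            if (t : ℕ) < k then X (σ ⟨t, by omega⟩)
            else if t = k then
              leibnizExt 𝒱 (n + b) (g b) (fun r => X (σ ⟨k + r, by omega⟩)) (X ⟨k + b, by omega⟩)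
            else X ⟨t + b, by omega⟩ := by
  have fixed := (mem_shuffles.1 hσ).2.2
  rw [shuffleTerm, wordInsert_nambuEval_Psi, smul_comm]
  refine congrArg _ (congrArg₂ _ rfl (congrArg (f a) (funext fun t => ?_)))
  simp only [Function.comp_apply]
  rw [fixed ⟨k + b, _⟩ le_rfl]
  split_ifs with hlt heq
  · rfl
  · rfl
  · rw [fixed ⟨t + b, _⟩ (by simp only [Fin.ext_iff] at heq ⊢; omega)]

theorem shuffleTerm_nambuEval_mul_nambuEval (n : ℤ) (f g : NambuCochain 𝕜 V) {a b : ℕ}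
    (d : Fin (a + b) → ℤ) (X : Fin (a + b) → V ⊗[𝕜] V) (σ : Equiv.Perm (Fin (a + b))) :
    shuffleTerm 𝕜 n (fun p q _ => nambuEval f p * nambuEval g q) (fun i => (d i + 1, X i)) a b σ =
      (triSign 𝕜 a * triSign 𝕜 b) •
        (sign 𝕜 (n * leadingDegree (fun i => d i + 1) σ a) *
            koszulSign 𝕜 (fun i => d i + 1) σ) •
          (f a (fun t => X (σ ⟨t, by omega⟩)) * g b (fun r => X (σ ⟨a + r, by omega⟩)) :
            Module.End 𝕜 V) := by
  rw [shuffleTerm, nambuEval_of_length_eq f (a := a) (by simp),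
    nambuEval_of_length_eq g (a := b) (by simp), smul_mul_smul_comm, smul_comm]
  refine congrArg _ (congrArg₂ _ rfl (congrArg₂ (· * ·) (congrArg (f a) (funext fun t => ?_))
    (congrArg (g b) (funext fun r => ?_))))
  · rw [letters_take _ t.2, letters_ofFn _ (by omega)]
    rfl
  · rw [letters_take _ r.2, letters_drop, letters_ofFn _ (by omega)]
    rfl

theorem nambuCircComponent_eq_sum_shuffleTerm (n : ℤ) (f g : NambuCochain 𝕜 V) {a b s : ℕ}
    (h : a + b = s) (d : Fin s → ℤ) (X : Fin s → V ⊗[𝕜] V) (x : V) :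
    nambuCircComponent 𝒱 n (f a) (g b) (fun i => d (Fin.cast h i)) (fun i => X (Fin.cast h i)) x =
      triSign 𝕜 s • (∑ k ∈ Finset.range a, ∑ σ ∈ shuffles s k b,
          shuffleTerm 𝕜 n (wordInsert n (nambuEval f) (wordEval (Psi 𝒱 n g)))
            (fun i => (d i + 1, X i)) k b σ +
        ∑ σ ∈ shuffles s a b, shuffleTerm 𝕜 n (fun p q _ => nambuEval f p * nambuEval g q)
          (fun i => (d i + 1, X i)) a b σ) x := by
  subst h
  have signs_eq : triSign 𝕜 (a + b) * (triSign 𝕜 a * triSign 𝕜 b) = sign 𝕜 (a * b) := by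
    rw [triSign_mul, ← mul_assoc, triSign_mul_self, one_mul]
  rw [Finset.sum_range, Finset.sum_congr rfl fun k _ => Finset.sum_congr rfl fun σ hσ =>
    shuffleTerm_wordInsert_nambuEval 𝒱 n f g d X k hσ]
  simp only [shuffleTerm_nambuEval_mul_nambuEval, ← Finset.smul_sum, ← smul_add]
  rw [LinearMap.smul_apply, smul_smul, signs_eq, nambuCircComponent]
  simp only [LinearMap.add_apply, LinearMap.sum_apply, LinearMap.smul_apply,
    Module.End.mul_apply, Fin.cast_eq_self]

theorem nambuCirc_eq_smul_nambuWordCirc (n : ℤ) (f g : NambuCochain 𝕜 V) (s : ℕ) (d : Fin s → ℤ)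
    (X : Fin s → V ⊗[𝕜] V) (x : V) : nambuCirc 𝒱 n f g s d X x =
      triSign 𝕜 s • nambuWordCirc 𝒱 n f g (List.ofFn fun i => (d i + 1, X i)) x := by
  rw [nambuCirc, Finset.sum_congr rfl fun p _ => nambuCircComponent_eq_sum_shuffleTerm 𝒱 n f g
      (Finset.HasAntidiagonal.mem_antidiagonal.1 p.2) d X x,
    ← Finset.smul_sum, ← LinearMap.sum_apply,
    Finset.sum_attach _ fun p : ℕ × ℕ => ∑ k ∈ Finset.range p.1, ∑ σ ∈ shuffles s k p.2,
        shuffleTerm 𝕜 n (wordInsert n (nambuEval f) (wordEval (Psi 𝒱 n g)))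
          (fun i => (d i + 1, X i)) k p.2 σ +
      ∑ σ ∈ shuffles s p.1 p.2, shuffleTerm 𝕜 n (fun p q _ => nambuEval f p * nambuEval g q)
        (fun i => (d i + 1, X i)) p.1 p.2 σ,
    Finset.sum_add_distrib, ← wordCirc_ofFn, ← wordConv_ofFn]
  rfl

variable {𝒱}

theorem courant_apply (two_ne_zero : (2 : 𝕜) ≠ 0) {m n : ℤ} {f g : NambuCochain 𝕜 V}
    (hf : f ∈ CV 𝒱 m) (hg : g ∈ CV 𝒱 n) (s : ℕ) (d : Fin s → ℤ) (X : Fin s → V ⊗[𝕜] V) (x : V)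
    (hX : ∀ i, X i ∈ tensorGrading 𝒱 (d i)) :
    courant 𝒱 m n f g s X x =
      nambuCirc 𝒱 n f g s d X x - sign 𝕜 (m * n) • nambuCirc 𝒱 m g f s d X x := by
  have eval_eq := nambuEval_courant two_ne_zero hf hg (isHomogeneousWord_suspTensor_ofFn.2 hX)
  calc courant 𝒱 m n f g s X x
      = triSign 𝕜 s • nambuEval (courant 𝒱 m n f g) (List.ofFn fun i => (d i + 1, X i)) x := by
        rw [nambuEval_ofFn, LinearMap.smul_apply, smul_smul, triSign_mul_self, one_smul]
    _ = nambuCirc 𝒱 n f g s d X x - sign 𝕜 (m * n) • nambuCirc 𝒱 m g f s d X x := by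
        rw [eval_eq, nambuCirc_eq_smul_nambuWordCirc, nambuCirc_eq_smul_nambuWordCirc,
          smul_comm (sign 𝕜 (m * n)), ← smul_sub]
        rfl

end NambuCircleProduct

section Transport

variable {𝕜 : Type u} [Field 𝕜] {M N : Type v} [AddCommGroup M] [Module 𝕜 M]
  [AddCommGroup N] [Module 𝕜 N]

theorem IsGradedLieAlgebra.jacobi_of_injOn {L : ℤ → Submodule 𝕜 M} {br : ℤ → ℤ → M → M → M}
    (hL : IsGradedLieAlgebra L br) {S : ℤ → Submodule 𝕜 N} {br' : ℤ → ℤ → N → N → N}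
    (Φ : ℤ → N →ₗ[𝕜] M) (mapsTo : ∀ n, Set.MapsTo (Φ n) (S n) (L n))
    (injOn : ∀ n, Set.InjOn (Φ n) (S n))
    (mem : ∀ {m n f g}, f ∈ S m → g ∈ S n → br' m n f g ∈ S (m + n))
    (map_br : ∀ {m n f g}, f ∈ S m → g ∈ S n →
      Φ (m + n) (br' m n f g) = br m n (Φ m f) (Φ n g))
    {m n p : ℤ} {f g h : N} (hf : f ∈ S m) (hg : g ∈ S n) (hh : h ∈ S p) :
    br' m (n + p) f (br' n p g h) = br' (m + n) p (br' m n f g) h +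
      sign 𝕜 (m * n) • br' n (m + p) g (br' m p f h) := by
  have left_mem := mem (mem hf hg) hh
  have map_left := map_br (mem hf hg) hh
  have right_mem := mem hg (mem hf hh)
  have map_right := map_br hg (mem hf hh)
  rw [add_assoc] at left_mem map_left
  rw [add_left_comm n m p] at right_mem map_right
  refine injOn (m + (n + p)) (mem hf (mem hg hh))
    (Submodule.add_mem _ left_mem (Submodule.smul_mem _ _ right_mem)) ?_
  rw [map_br hf (mem hg hh), map_add, map_smul, map_left, map_right, map_br hg hh, map_br hf hg,
    map_br hf hh, hL.jacobi m n p _ (mapsTo m hf) _ (mapsTo n hg) _ (mapsTo p hh)]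

theorem IsGradedLieAlgebra.of_injOn {L : ℤ → Submodule 𝕜 M} {br : ℤ → ℤ → M → M → M}
    (hL : IsGradedLieAlgebra L br) {S : ℤ → Submodule 𝕜 N} {br' : ℤ → ℤ → N → N → N}
    (Φ : ℤ → N →ₗ[𝕜] M) (mapsTo : ∀ n, Set.MapsTo (Φ n) (S n) (L n))
    (injOn : ∀ n, Set.InjOn (Φ n) (S n))
    (mem : ∀ {m n f g}, f ∈ S m → g ∈ S n → br' m n f g ∈ S (m + n))
    (map_br : ∀ {m n f g}, f ∈ S m → g ∈ S n →
      Φ (m + n) (br' m n f g) = br m n (Φ m f) (Φ n g)) :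
    IsGradedLieAlgebra S br' where
  mem _ _ _ hf _ hg := mem hf hg
  add_left m n f hf f' hf' g hg := by
    have hff' := Submodule.add_mem _ hf hf'
    refine injOn (m + n) (mem hff' hg) (Submodule.add_mem _ (mem hf hg) (mem hf' hg)) ?_
    rw [map_br hff' hg, map_add, map_add, map_br hf hg, map_br hf' hg,
      hL.add_left m n _ (mapsTo m hf) _ (mapsTo m hf') _ (mapsTo n hg)]
  smul_left m n c f hf g hg := by
    have hcf := Submodule.smul_mem _ c hf
    refine injOn (m + n) (mem hcf hg) (Submodule.smul_mem _ c (mem hf hg)) ?_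
    rw [map_br hcf hg, map_smul, map_smul, map_br hf hg,
      hL.smul_left m n c _ (mapsTo m hf) _ (mapsTo n hg)]
  add_right m n f hf g hg g' hg' := by
    have hgg' := Submodule.add_mem _ hg hg'
    refine injOn (m + n) (mem hf hgg') (Submodule.add_mem _ (mem hf hg) (mem hf hg')) ?_
    rw [map_br hf hgg', map_add, map_add, map_br hf hg, map_br hf hg',
      hL.add_right m n _ (mapsTo m hf) _ (mapsTo n hg) _ (mapsTo n hg')]
  smul_right m n c f hf g hg := by
    have hcg := Submodule.smul_mem _ c hg
    refine injOn (m + n) (mem hf hcg) (Submodule.smul_mem _ c (mem hf hg)) ?_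
    rw [map_br hf hcg, map_smul, map_smul, map_br hf hg,
      hL.smul_right m n c _ (mapsTo m hf) _ (mapsTo n hg)]
  antisymm m n f hf g hg := by
    have mem_swap := mem hg hf
    have map_swap := map_br hg hf
    rw [add_comm n m] at mem_swap map_swap
    refine injOn (m + n) (mem hf hg) (Submodule.neg_mem _ (Submodule.smul_mem _ _ mem_swap)) ?_
    rw [map_br hf hg, map_neg, map_smul, map_swap,
      hL.antisymm m n _ (mapsTo m hf) _ (mapsTo n hg)]
  jacobi _ _ _ _ hf _ hg _ hh := hL.jacobi_of_injOn Φ mapsTo injOn mem map_br hf hg hh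

end Transport

section NambuLieAlgebra

variable {𝕜 : Type u} [Field 𝕜] {V : Type v} [AddCommGroup V] [Module 𝕜 V]
  (𝒱 : ℤ → Submodule 𝕜 V) [DirectSum.Decomposition 𝒱]

theorem isGradedLieSubalgebra_map_Psi :
    IsGradedLieSubalgebra (CLV (suspTensor 𝒱)) (balavoineBracket (suspTensor 𝒱))
      fun n => (CV 𝒱 n).map (Psi 𝒱 n) where
  isGradedLieAlgebra := isGradedLieAlgebra_CLV (suspTensor 𝒱)
  le n := Submodule.map_le_iff_le_comap.2 (mapsTo_Psi 𝒱 n)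
  bracket_mem := by
    rintro m n _ ⟨f, hf, rfl⟩ _ ⟨g, hg, rfl⟩
    exact ⟨courant 𝒱 m n f g, courant_mem_CV hf hg, Psi_courant hf hg⟩

theorem isGradedLieAlgebra_courant (two_ne_zero : (2 : 𝕜) ≠ 0) :
    IsGradedLieAlgebra (CV 𝒱) (courant 𝒱) :=
  (isGradedLieAlgebra_CLV (suspTensor 𝒱)).of_injOn (Psi 𝒱) (mapsTo_Psi 𝒱)
    (injOn_Psi two_ne_zero) courant_mem_CV Psi_courant

variable {𝒱}

theorem courant_self_apply (two_ne_zero : (2 : 𝕜) ≠ 0) {O : NambuCochain 𝕜 V} (hO : O ∈ CV 𝒱 1)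
    (s : ℕ) (d : Fin s → ℤ) (X : Fin s → V ⊗[𝕜] V) (x : V)
    (hX : ∀ i, X i ∈ tensorGrading 𝒱 (d i)) :
    courant 𝒱 1 1 O O s X x = (2 : 𝕜) • nambuCirc 𝒱 1 O O s d X x := by
  have sign_one : sign 𝕜 (1 * 1) = -1 := by simp [sign]
  rw [courant_apply two_ne_zero hO hO s d X x hX, sign_one, neg_one_smul, sub_neg_eq_add, two_smul]

theorem courant_self_eq_zero_iff (two_ne_zero : (2 : 𝕜) ≠ 0) {O : NambuCochain 𝕜 V}
    (hO : O ∈ CV 𝒱 1) : courant 𝒱 1 1 O O = 0 ↔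
      ∀ (s : ℕ) (d : Fin s → ℤ) (X : Fin s → V ⊗[𝕜] V) (x : V),
        (∀ i, X i ∈ tensorGrading 𝒱 (d i)) → nambuCirc 𝒱 1 O O s d X x = 0 := by
  constructor
  · intro courant_eq_zero s d X x hX
    have smul_eq_zero_of_courant := courant_self_apply two_ne_zero hO s d X x hX
    rw [courant_eq_zero] at smul_eq_zero_of_courant
    exact (smul_eq_zero.1 smul_eq_zero_of_courant.symm).resolve_left two_ne_zero
  · intro identity
    refine funext fun s => multilinearMap_ext_of_homogeneous (tensorGrading 𝒱) fun d X hX =>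
      LinearMap.ext fun x => ?_
    rw [courant_self_apply two_ne_zero hO s d X x hX, identity s d X x hX, smul_zero]
    rfl

variable (𝒱) in
theorem isMaurerCartan_iff_isHomotopyNambu (two_ne_zero : (2 : 𝕜) ≠ 0) (O : NambuCochain 𝕜 V) :
    IsMaurerCartan (CV 𝒱) (courant 𝒱) O ↔ IsHomotopyNambu 𝒱 O := by
  have mem_CV_one_iff : O ∈ CV 𝒱 1 ↔ ∀ (a : ℕ) (d : Fin a → ℤ) (c : ℤ)
      (X : Fin a → V ⊗[𝕜] V) (x : V), (∀ i, X i ∈ tensorGrading 𝒱 (d i)) → x ∈ 𝒱 c →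
        O a X x ∈ 𝒱 (∑ i, d i + c + (a + 1)) := by
    simp only [add_comm _ (1 : ℤ)]
    rfl
  constructor
  · rintro ⟨hO, courant_eq_zero⟩
    exact ⟨mem_CV_one_iff.1 hO, (courant_self_eq_zero_iff two_ne_zero hO).1 courant_eq_zero⟩
  · rintro ⟨degree, identity⟩
    have hO := mem_CV_one_iff.2 degree
    exact ⟨hO, (courant_self_eq_zero_iff two_ne_zero hO).2 identity⟩

end NambuLieAlgebra

end Nambu

end

/-- Let `V` be a graded vector space over a field of characteristic not two. The map `Ψ` is an
injective graded linear map from `CV` to `CLV` of `s(V ⊗ V)`, its image is a graded Lie subalgebra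
for the graded Balavoine bracket, the transported bracket makes `CV` a graded Lie algebra (and is
given by an explicit formula), and its Maurer-Cartan elements are exactly the homotopy Nambu
algebra structures on `V`. -/
theorem mainTheorem3 {𝕜 : Type*} [Field 𝕜] (two_ne_zero : (2 : 𝕜) ≠ 0)
    {V : Type*} [AddCommGroup V] [Module 𝕜 V]
    (𝒱 : ℤ → Submodule 𝕜 V) [DirectSum.Decomposition 𝒱] :
    (∀ n : ℤ, Set.MapsTo (Nambu.Psi 𝒱 n) (Nambu.CV 𝒱 n) (Nambu.CLV (Nambu.suspTensor 𝒱) n) ∧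
      Set.InjOn (Nambu.Psi 𝒱 n) (Nambu.CV 𝒱 n)) ∧
    Nambu.IsGradedLieSubalgebra (Nambu.CLV (Nambu.suspTensor 𝒱))
      (Nambu.balavoineBracket (Nambu.suspTensor 𝒱))
      (fun n => (Nambu.CV 𝒱 n).map (Nambu.Psi 𝒱 n)) ∧
    Nambu.IsGradedLieAlgebra (Nambu.CV 𝒱) (Nambu.courant 𝒱) ∧
    (∀ m n : ℤ, ∀ f ∈ Nambu.CV 𝒱 m, ∀ g ∈ Nambu.CV 𝒱 n,
      Nambu.Psi 𝒱 (m + n) (Nambu.courant 𝒱 m n f g) =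
        Nambu.balavoineBracket (Nambu.suspTensor 𝒱) m n (Nambu.Psi 𝒱 m f) (Nambu.Psi 𝒱 n g) ∧
      ∀ (s : ℕ) (d : Fin s → ℤ) (X : Fin s → V ⊗[𝕜] V) (x : V),
        (∀ i, X i ∈ Nambu.tensorGrading 𝒱 (d i)) →
          Nambu.courant 𝒱 m n f g s X x =
            Nambu.nambuCirc 𝒱 n f g s d X x -
              Nambu.sign 𝕜 (m * n) • Nambu.nambuCirc 𝒱 m g f s d X x) ∧
    (∀ O : Nambu.NambuCochain 𝕜 V,
      Nambu.IsMaurerCartan (Nambu.CV 𝒱) (Nambu.courant 𝒱) O ↔ Nambu.IsHomotopyNambu 𝒱 O) :=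
  ⟨fun n => ⟨Nambu.mapsTo_Psi 𝒱 n, Nambu.injOn_Psi two_ne_zero n⟩,
    Nambu.isGradedLieSubalgebra_map_Psi 𝒱,
    Nambu.isGradedLieAlgebra_courant 𝒱 two_ne_zero,
    fun _ _ _ hf _ hg => ⟨Nambu.Psi_courant hf hg, Nambu.courant_apply two_ne_zero hf hg⟩,
    Nambu.isMaurerCartan_iff_isHomotopyNambu 𝒱 two_ne_zero⟩
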